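/- Let $\mathfrak g$ be a finite-dimensional real Lie algebra. A complex structure on $\mathfrak g$ is a linear map $J:\mathfrak g\to\mathfrak g$ with $J^2=-\mathrm{Id}$ and $[JX,JY]=J[JX,Y]+J[X,JY]+[X,Y]$ for all $X,Y\in\mathfrak g$. Put $\mathfrak g_0^J=\{0\}$ and, for $l\ge 1$, $\mathfrak g_l^J=\{X\in\mathfrak g : [X,\mathfrak g]\subseteq \mathfrak g_{l-1}^J \text{ and } [JX,\mathfrak g]\subseteq\mathfrak g_{l-1}^J\}$; $J$ is called non-nilpotent if $\mathfrak g_l^J\neq\mathfrak g$ for all $l$. Complex structures $J$ on $\mathfrak g$ and $J'$ on $\mathfrak g'$ are equivalent if there is a Lie algebra isomorphism $A:\mathfrak g\to\mathfrak g'$ with $J'A=AJ$. Complex $1$-forms $\omega$ of type $(1,0)$ are those with $J\omega=i\omega$, where $(J\omega)(X)=-\omega(JX)$, and $(d\omega)(X,Y)=-\omega([X,Y])$. Denote by $(0,0,0,12,23,14-35)$ the $6$-dimensional real Lie algebra whose dual has a basis $e^1,\dots,e^6$ with $de^1=de^2=de^3=0$, $de^4=e^1\wedge e^2$, $de^5=e^2\wedge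 e^3$, $de^6=e^1\wedge e^4-e^3\wedge e^5$, and by $(0,0,12,13,23,14+25)$ the one with $de^1=de^2=0$, $de^3=e^1\wedge e^2$, $de^4=e^1\wedge e^3$, $de^5=e^2\wedge e^3$, $de^6=e^1\wedge e^4+e^2\wedge e^5$. These two Lie algebras are nilpotent and not isomorphic, and the following hold. 1. A $6$-dimensional nilpotent real Lie algebra admits a non-nilpotent complex structure if and only if it is isomorphic to $(0,0,0,12,23,14-35)$ or to $(0,0,12,13,23,14+25)$. 2. Let $J$ be a non-nilpotent complex structure on a $6$-dimensional nilpotent real Lie algebra $\mathfrak g$. Then for some $\epsilon\in\{0,1\}$ and some choice of sign there is a basis $\omega^1,\omega^2,\omega^3$ of the $(1,0)$-forms such that $$d\omega^1=0,\qquad d\omega^2=\omega^1\wedge\omega^3+\omega^1\wedge\overline{\omega^3},\qquad d\omega^3=i\epsilon\,\omega^1\wedge\overline{\omega^1}\pm i\,(\omega^1\wedge\overline{\omega^2}-\omega^2\wedge\overline{\omega^1}).$$ Whenever such a basis exists with $\epsilon=0$, $\mathfrak g\cong(0,0,0,12,23,14-35)$; whenever one exists with $\epsilon=1$, $\mathfrak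 g\cong(0,0,12,13,23,14+25)$. 3. Every complex structure on either of the two Lie algebras is non-nilpotent, and on each of them there are exactly two complex structures up to equivalence. -/

import Mathlib

namespace NilCx

section Forms

variable {g : Type*} [LieRing g] [LieAlgebra ℝ g] {A : Type*} [CommRing A] [Algebra ℝ A]

/-- The Chevalley-Eilenberg differential of a 1-form: `(dω)(X, Y) = -ω([X, Y])`.
For `A = ℂ`, `g →ₗ[ℝ] ℂ` is the dual of the complexification of `g`. -/
def d (ω : g →ₗ[ℝ] A) : g → g → A := fun X Y => -ω ⁅X, Y⁆

/-- The wedge product of two 1-forms. -/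
def wedge (α β : g →ₗ[ℝ] A) : g → g → A := fun X Y => α X * β Y - α Y * β X

/-- The complex conjugate of a complex-valued 1-form. -/
noncomputable def conj (ω : g →ₗ[ℝ] ℂ) : g →ₗ[ℝ] ℂ := Complex.conjAe.toLinearMap ∘ₗ ω

end Forms

section ComplexStructures

variable {g : Type*} [LieRing g] [LieAlgebra ℝ g]

/-- A complex structure on a real Lie algebra: `J² = -Id` together with the Nijenhuis condition. -/
structure IsComplexStructure (J : g →ₗ[ℝ] g) : Prop where
  sq_eq : ∀ X, J (J X) = -X
  nijenhuis : ∀ X Y, ⁅J X, J Y⁆ = J ⁅J X, Y⁆ + J ⁅X, J Y⁆ + ⁅X, Y⁆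

/-- The ascending series adapted to `J`: the `0`-th term is `0`, and the `(l+1)`-st consists of
the `X` such that `[X, g]` and `[J X, g]` lie in the `l`-th term. -/
def ascendingSeries (J : g →ₗ[ℝ] g) : ℕ → Submodule ℝ g
  | 0 => ⊥
  | l + 1 =>
    { carrier := {X | ∀ Y, ⁅X, Y⁆ ∈ ascendingSeries J l ∧ ⁅J X, Y⁆ ∈ ascendingSeries J l}
      add_mem' := by
        intro a b ha hb Y
        rw [map_add, add_lie, add_lie]
        exact ⟨add_mem (ha Y).1 (hb Y).1, add_mem (ha Y).2 (hb Y).2⟩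
      zero_mem' := by
        intro Y
        simp
      smul_mem' := by
        intro c x hx Y
        rw [map_smul, smul_lie, smul_lie]
        exact ⟨Submodule.smul_mem _ c (hx Y).1, Submodule.smul_mem _ c (hx Y).2⟩ }

/-- `J` is a non-nilpotent complex structure: its ascending series never reaches `g`. -/
def IsNonNilpotentComplexStructure (J : g →ₗ[ℝ] g) : Prop :=
  IsComplexStructure J ∧ ¬ ∃ l : ℕ, ascendingSeries J l = ⊤

/-- The space of complex 1-forms of type `(1,0)`: the `i`-eigenspace of the action
`(Jω)(X) = -ω(JX)` of `J` on complex 1-forms. -/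
def forms10 (J : g →ₗ[ℝ] g) : Submodule ℂ (g →ₗ[ℝ] ℂ) where
  carrier := {ω | ∀ X, -ω (J X) = Complex.I * ω X}
  add_mem' := by
    intro a b ha hb X
    simp only [LinearMap.add_apply, neg_add, mul_add]
    rw [ha X, hb X]
  zero_mem' := by
    intro X
    simp
  smul_mem' := by
    intro c x hx X
    simp only [LinearMap.smul_apply, smul_eq_mul]
    rw [← mul_neg, hx X]
    ring

/-- There is a basis `ω¹, ω², ω³` of the `(1,0)`-forms of `J` with
`dω¹ = 0`, `dω² = ω¹ ∧ (ω³ + ω̄³)`, `dω³ = iε ω¹ ∧ ω̄¹ + ic (ω¹ ∧ ω̄² - ω² ∧ ω̄¹)`.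
It is used with `ε = 0, 1` and `c = ±1`. -/
def HasReducedBasis (J : g →ₗ[ℝ] g) (ε c : ℝ) : Prop :=
  ∃ b : Module.Basis (Fin 3) ℂ (forms10 J), ∃ ω₁ ω₂ ω₃ : g →ₗ[ℝ] ℂ,
    ω₁ = (b 0 : g →ₗ[ℝ] ℂ) ∧ ω₂ = (b 1 : g →ₗ[ℝ] ℂ) ∧ ω₃ = (b 2 : g →ₗ[ℝ] ℂ) ∧
    d ω₁ = 0 ∧
    d ω₂ = wedge ω₁ ω₃ + wedge ω₁ (conj ω₃) ∧
    d ω₃ = (Complex.I * (ε : ℂ)) • wedge ω₁ (conj ω₁) +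
      (Complex.I * (c : ℂ)) • (wedge ω₁ (conj ω₂) - wedge ω₂ (conj ω₁))

/-- `J` on `g` and `J'` on `g'` are equivalent: some isomorphism of Lie algebras
intertwines them. -/
def Equivalent {g' : Type*} [LieRing g'] [LieAlgebra ℝ g']
    (J : g →ₗ[ℝ] g) (J' : g' →ₗ[ℝ] g') : Prop :=
  ∃ A : g ≃ₗ⁅ℝ⁆ g', ∀ X, J' (A X) = A (J X)

end ComplexStructures

/-- Equivalence as a relation on the set of all complex structures of a fixed Lie algebra. -/
def complexStructureSetoid (g : Type*) [LieRing g] [LieAlgebra ℝ g] :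
    Setoid {J : g →ₗ[ℝ] g // IsComplexStructure J} where
  r J J' := Equivalent J.1 J'.1
  iseqv :=
    { refl := fun _ => ⟨LieEquiv.refl, fun _ => rfl⟩
      symm := by
        rintro J J' ⟨A, hA⟩
        refine ⟨A.symm, fun X => ?_⟩
        have h := hA (A.symm X)
        rw [A.apply_symm_apply] at h
        rw [h, A.symm_apply_apply]
      trans := by
        rintro J J' J'' ⟨A, hA⟩ ⟨B, hB⟩
        refine ⟨A.trans B, fun X => ?_⟩
        rw [LieEquiv.trans_apply, LieEquiv.trans_apply, hB, hA] }

/-- The complex structures of a Lie algebra up to equivalence. -/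
def ComplexStructureClasses (g : Type*) [LieRing g] [LieAlgebra ℝ g] : Type _ :=
  Quotient (complexStructureSetoid g)

/-- The Lie algebra `(0, 0, 0, 12, 23, 14 - 35)`: its underlying space is `ℝ⁶`. -/
def H19m : Type := Fin 6 → ℝ

namespace H19m

noncomputable instance : AddCommGroup H19m := inferInstanceAs (AddCommGroup (Fin 6 → ℝ))

noncomputable instance : Module ℝ H19m := inferInstanceAs (Module ℝ (Fin 6 → ℝ))

/-- The Lie bracket, dual to the structure equations. -/
def bracket (x y : Fin 6 → ℝ) : Fin 6 → ℝ :=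
  ![0, 0, 0, -(x 0 * y 1 - x 1 * y 0), -(x 1 * y 2 - x 2 * y 1),
    -((x 0 * y 3 - x 3 * y 0) - (x 2 * y 4 - x 4 * y 2))]

noncomputable instance : LieRing H19m where
  bracket := bracket
  add_lie x y z := by
    change bracket (fun i => x i + y i) z = fun i => bracket x z i + bracket y z i
    funext i
    fin_cases i <;> simp [bracket] <;> ring
  lie_add x y z := by
    change bracket x (fun i => y i + z i) = fun i => bracket x y i + bracket x z i
    funext i
    fin_cases i <;> simp [bracket] <;> ring
  lie_self x := by
    change bracket x x = fun _ => 0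
    funext i
    fin_cases i <;> simp [bracket] <;> ring
  leibniz_lie x y z := by
    change bracket x (bracket y z) =
      fun i => bracket (bracket x y) z i + bracket y (bracket x z) i
    funext i
    fin_cases i <;> simp [bracket] <;> ring

noncomputable instance : LieAlgebra ℝ H19m where
  lie_smul t x y := by
    change bracket x (fun i => t * y i) = fun i => t * bracket x y i
    funext i
    fin_cases i <;> simp [bracket] <;> ring

/-- The coordinate 1-forms; `coord i` is the form written `e^{i+1}` in the structure equations. -/
noncomputable def coord (i : Fin 6) : H19m →ₗ[ℝ] ℝ :=
  (LinearMap.proj i : (Fin 6 → ℝ) →ₗ[ℝ] ℝ)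

theorem structure_equations :
    d (coord 0) = 0 ∧ d (coord 1) = 0 ∧ d (coord 2) = 0 ∧
    d (coord 3) = wedge (coord 0) (coord 1) ∧
    d (coord 4) = wedge (coord 1) (coord 2) ∧
    d (coord 5) = wedge (coord 0) (coord 3) - wedge (coord 2) (coord 4) := by
  refine ⟨?_, ?_, ?_, ?_, ?_, ?_⟩ <;> funext x y
  · change -(bracket x y 0) = 0
    simp [bracket]
  · change -(bracket x y 1) = 0
    simp [bracket]
  · change -(bracket x y 2) = 0
    simp [bracket]
  · change -(bracket x y 3) = x 0 * y 1 - y 0 * x 1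
    simp [bracket]; ring
  · change -(bracket x y 4) = x 1 * y 2 - y 1 * x 2
    simp [bracket]; ring
  · change -(bracket x y 5) = (x 0 * y 3 - y 0 * x 3) - (x 2 * y 4 - y 2 * x 4)
    simp [bracket]; ring

end H19m

/-- The Lie algebra `(0, 0, 12, 13, 23, 14 + 25)`: its underlying space is `ℝ⁶`. -/
def H26p : Type := Fin 6 → ℝ

namespace H26p

noncomputable instance : AddCommGroup H26p := inferInstanceAs (AddCommGroup (Fin 6 → ℝ))

noncomputable instance : Module ℝ H26p := inferInstanceAs (Module ℝ (Fin 6 → ℝ))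

/-- The Lie bracket, dual to the structure equations. -/
def bracket (x y : Fin 6 → ℝ) : Fin 6 → ℝ :=
  ![0, 0, -(x 0 * y 1 - x 1 * y 0), -(x 0 * y 2 - x 2 * y 0), -(x 1 * y 2 - x 2 * y 1),
    -((x 0 * y 3 - x 3 * y 0) + (x 1 * y 4 - x 4 * y 1))]

noncomputable instance : LieRing H26p where
  bracket := bracket
  add_lie x y z := by
    change bracket (fun i => x i + y i) z = fun i => bracket x z i + bracket y z i
    funext i
    fin_cases i <;> simp [bracket] <;> ring
  lie_add x y z := by
    change bracket x (fun i => y i + z i) = fun i => bracket x y i + bracket x z i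
    funext i
    fin_cases i <;> simp [bracket] <;> ring
  lie_self x := by
    change bracket x x = fun _ => 0
    funext i
    fin_cases i <;> simp [bracket] <;> ring
  leibniz_lie x y z := by
    change bracket x (bracket y z) =
      fun i => bracket (bracket x y) z i + bracket y (bracket x z) i
    funext i
    fin_cases i <;> simp [bracket] <;> ring

noncomputable instance : LieAlgebra ℝ H26p where
  lie_smul t x y := by
    change bracket x (fun i => t * y i) = fun i => t * bracket x y i
    funext i
    fin_cases i <;> simp [bracket] <;> ring

/-- The coordinate 1-forms; `coord i` is the form written `e^{i+1}` in the structure equations. -/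
noncomputable def coord (i : Fin 6) : H26p →ₗ[ℝ] ℝ :=
  (LinearMap.proj i : (Fin 6 → ℝ) →ₗ[ℝ] ℝ)

theorem structure_equations :
    d (coord 0) = 0 ∧ d (coord 1) = 0 ∧
    d (coord 2) = wedge (coord 0) (coord 1) ∧
    d (coord 3) = wedge (coord 0) (coord 2) ∧
    d (coord 4) = wedge (coord 1) (coord 2) ∧
    d (coord 5) = wedge (coord 0) (coord 3) + wedge (coord 1) (coord 4) := by
  refine ⟨?_, ?_, ?_, ?_, ?_, ?_⟩ <;> funext x y
  · change -(bracket x y 0) = 0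
    simp [bracket]
  · change -(bracket x y 1) = 0
    simp [bracket]
  · change -(bracket x y 2) = x 0 * y 1 - y 0 * x 1
    simp [bracket]; ring
  · change -(bracket x y 3) = x 0 * y 2 - y 0 * x 2
    simp [bracket]; ring
  · change -(bracket x y 4) = x 1 * y 2 - y 1 * x 2
    simp [bracket]; ring
  · change -(bracket x y 5) = (x 0 * y 3 - y 0 * x 3) + (x 1 * y 4 - y 1 * x 4)
    simp [bracket]; ring

end H26p

end NilCx

/-! Everything reduces to one two-parameter model with basis X, JX, Y, JY, C, JC.

In dimension 6, non-nilpotency of J means that no nonzero x has both x and Jx central. The adapted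
series stabilises at a proper J-stable ideal, and the quotient by that ideal has this property. A
nonzero nilpotent algebra with this property has dimension at least 6
(`IsComplexStructure.six_le_finrank`), so the ideal is zero.

To see the bound, take C ≠ 0 central. Integrability makes D = ad(JC) commute with J. As D is
nilpotent and nonzero, some X has Y = DX ≠ 0 and DY = 0, and then X, JX, Y, JY, C, JC are
independent. In dimension 6 they form a basis. Nilpotency, the Jacobi identity and integrability
leave only [X, Y] = [JX, JY] = δC with δ ≠ 0, the brackets with JC, and [X, JX] in ker D
(`IsComplexStructure.exists_isFrame`). Shifting X leaves [X, JX] = s JC, and rescaling X and C gives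
δ = ±1 and s ∈ {0, 1}.

Conversely, the centre of each model is a line, which no complex structure preserves; hence every
complex structure on it is non-nilpotent. The value of ε is an invariant of the algebra, through the
vanishing of (ad x)³, and c = ±1 is an invariant of J, through the sign in [x, [x, Jz]] = c(x₀² +
x₁²)z for central z. Both signs occur on each algebra, which gives two classes. -/

namespace NilCx

/-! ### The model algebra and its invariants -/

section Model

/-- The bracket of the model algebra in coordinates with respect to a basis
`X, JX, Y, JY, C, JC` with `[X, JC] = -Y`, `[JX, JC] = -JY`, `[X, Y] = [JX, JY] = -c C` and
`[X, JX] = ε JC`. -/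
def modelBracket (ε c : ℝ) (x y : Fin 6 → ℝ) : Fin 6 → ℝ :=
  ![0, 0, -(x 0 * y 5 - x 5 * y 0), -(x 1 * y 5 - x 5 * y 1),
    -c * (x 0 * y 2 - x 2 * y 0 + x 1 * y 3 - x 3 * y 1), ε * (x 0 * y 1 - x 1 * y 0)]

/-- The complex structure of the model algebra. -/
def modelJ : (Fin 6 → ℝ) →ₗ[ℝ] (Fin 6 → ℝ) where
  toFun x := ![-x 1, x 0, -x 3, x 2, -x 5, x 4]
  map_add' x y := by
    funext i
    fin_cases i <;> simp <;> ring
  map_smul' t x := by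
    funext i
    fin_cases i <;> simp

theorem modelJ_apply (x : Fin 6 → ℝ) : modelJ x = ![-x 1, x 0, -x 3, x 2, -x 5, x 4] := rfl

variable {g g' : Type*} [LieRing g] [LieAlgebra ℝ g] [LieRing g'] [LieAlgebra ℝ g']

/-- The linear coordinates `e` identify the Lie algebra with the model algebra. -/
def IsModel (e : g ≃ₗ[ℝ] (Fin 6 → ℝ)) (ε c : ℝ) : Prop :=
  ∀ x y, e ⁅x, y⁆ = modelBracket ε c (e x) (e y)

/-- The linear coordinates `e` identify `J` with the complex structure of the model. -/
def IsAdapted (e : g ≃ₗ[ℝ] (Fin 6 → ℝ)) (J : g →ₗ[ℝ] g) : Prop :=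
  ∀ x, e (J x) = modelJ (e x)

/-- The isomorphism between two Lie algebras identified with the same model. -/
def IsModel.lieEquiv {e : g ≃ₗ[ℝ] (Fin 6 → ℝ)} {e' : g' ≃ₗ[ℝ] (Fin 6 → ℝ)} {ε c : ℝ}
    (h : IsModel e ε c) (h' : IsModel e' ε c) : g ≃ₗ⁅ℝ⁆ g' :=
  { e.trans e'.symm with
    map_lie' := by
      intro x y
      apply e'.injective
      simp [h x y, h' _ _] }

theorem IsModel.apply_lieEquiv {e : g ≃ₗ[ℝ] (Fin 6 → ℝ)} {e' : g' ≃ₗ[ℝ] (Fin 6 → ℝ)} {ε c : ℝ}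
    (h : IsModel e ε c) (h' : IsModel e' ε c) (x : g) : e' (h.lieEquiv h' x) = e x :=
  e'.apply_symm_apply (e x)

theorem IsModel.equivalent {e : g ≃ₗ[ℝ] (Fin 6 → ℝ)} {e' : g' ≃ₗ[ℝ] (Fin 6 → ℝ)} {ε c : ℝ}
    (h : IsModel e ε c) (h' : IsModel e' ε c) {J : g →ₗ[ℝ] g} {J' : g' →ₗ[ℝ] g'}
    (hJ : IsAdapted e J) (hJ' : IsAdapted e' J') : Equivalent J J' := by
  refine ⟨h.lieEquiv h', fun X => e'.injective ?_⟩
  rw [hJ', h.apply_lieEquiv, h.apply_lieEquiv, hJ]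

theorem IsModel.comp {e : g ≃ₗ[ℝ] (Fin 6 → ℝ)} {ε c : ℝ} (h : IsModel e ε c) (A : g' ≃ₗ⁅ℝ⁆ g) :
    IsModel (A.toLinearEquiv.trans e) ε c := by
  intro x y
  have := h (A x) (A y)
  rw [← LieEquiv.map_lie] at this
  exact this

theorem IsAdapted.of_equivalence {e : g ≃ₗ[ℝ] (Fin 6 → ℝ)} {J : g →ₗ[ℝ] g} {J' : g' →ₗ[ℝ] g'}
    (h : IsAdapted e J) {A : g' ≃ₗ⁅ℝ⁆ g} (hA : ∀ X, J (A X) = A (J' X)) :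
    IsAdapted (A.toLinearEquiv.trans e) J' := by
  intro x
  have := h (A x)
  rw [hA] at this
  exact this

theorem exists_isAdapted (e : g ≃ₗ[ℝ] (Fin 6 → ℝ)) : ∃ J : g →ₗ[ℝ] g, IsAdapted e J :=
  ⟨e.symm.toLinearMap ∘ₗ modelJ ∘ₗ e.toLinearMap, fun x => by simp⟩

theorem IsModel.isComplexStructure {e : g ≃ₗ[ℝ] (Fin 6 → ℝ)} {ε c : ℝ} (h : IsModel e ε c)
    {J : g →ₗ[ℝ] g} (hJ : IsAdapted e J) : IsComplexStructure J where
  sq_eq X := by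
    apply e.injective
    rw [hJ, hJ, map_neg]
    funext i
    fin_cases i <;> simp [modelJ_apply]
  nijenhuis X Y := by
    apply e.injective
    simp only [map_add, hJ _, h _ _]
    funext i
    fin_cases i <;> simp [modelJ_apply, modelBracket] <;> ring

/-- Bracketing with JC detects the coordinates along X and JX; bracketing with X detects those along
Y and JC, and with JX the one along JY. -/
theorem IsModel.apply_eq_of_central {e : g ≃ₗ[ℝ] (Fin 6 → ℝ)} {ε c : ℝ} (h : IsModel e ε c)
    (hc : c ≠ 0) {x : g} (hx : ∀ y : g, ⁅x, y⁆ = 0) : e x = ![0, 0, 0, 0, e x 4, 0] := by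
  have key : ∀ y i, modelBracket ε c (e x) y i = 0 := by
    intro y i
    have := h x (e.symm y)
    rw [hx, map_zero, e.apply_symm_apply] at this
    rw [← this]; rfl
  have h0 := key (Pi.single 5 1) 2
  have h1 := key (Pi.single 5 1) 3
  have h5 := key (Pi.single 0 1) 2
  have h2 := key (Pi.single 0 1) 4
  have h3 := key (Pi.single 1 1) 4
  simp [modelBracket, hc] at h0 h1 h2 h3 h5
  funext i
  fin_cases i <;> simp [h0, h1, h2, h3, h5]

theorem ascendingSeries_eq_bot {J : g →ₗ[ℝ] g}
    (h : ∀ x : g, (∀ y : g, ⁅x, y⁆ = 0) → (∀ y : g, ⁅J x, y⁆ = 0) → x = 0) (l : ℕ) :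
    ascendingSeries J l = ⊥ := by
  induction l with
  | zero => rfl
  | succ l ih =>
    rw [eq_bot_iff]
    intro x hx
    have hx' : ∀ y : g, ⁅x, y⁆ ∈ ascendingSeries J l ∧ ⁅J x, y⁆ ∈ ascendingSeries J l := hx
    simp only [ih, Submodule.mem_bot] at hx'
    exact h x (fun y => (hx' y).1) fun y => (hx' y).2

/-- The centre is the line of C. If x and Jx were both central with x ≠ 0, then Jx = tx with t² =
-1. So the adapted series never leaves 0, for any J, adapted to the coordinates or not. -/
theorem IsModel.isNonNilpotent {e : g ≃ₗ[ℝ] (Fin 6 → ℝ)} {ε c : ℝ} (h : IsModel e ε c)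
    (hc : c ≠ 0) {J : g →ₗ[ℝ] g} (hJ : IsComplexStructure J) :
    IsNonNilpotentComplexStructure J := by
  refine ⟨hJ, ?_⟩
  rintro ⟨l, hl⟩
  rw [ascendingSeries_eq_bot] at hl
  · have : (e.symm (Pi.single 0 1)) ∈ (⊥ : Submodule ℝ g) := hl ▸ Submodule.mem_top
    rw [Submodule.mem_bot, LinearEquiv.map_eq_zero_iff] at this
    simpa using congrFun this 0
  · intro x hx hJx
    by_contra hx0
    have e1 := h.apply_eq_of_central hc hx
    have e2 := h.apply_eq_of_central hc hJx
    have h4 : e x 4 ≠ 0 := by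
      intro h4
      rw [h4] at e1
      apply hx0
      apply e.injective
      rw [e1, map_zero]
      funext i
      fin_cases i <;> rfl
    obtain ⟨t, ht⟩ : ∃ t : ℝ, J x = t • x := by
      refine ⟨e (J x) 4 / e x 4, e.injective ?_⟩
      rw [map_smul, e1, e2]
      funext i
      fin_cases i <;> simp [h4]
    have h2 := hJ.sq_eq x
    rw [ht, map_smul, ht, smul_smul] at h2
    have h3 : (t * t + 1) • x = 0 := by rw [add_smul, h2, one_smul, neg_add_cancel]
    rcases smul_eq_zero.mp h3 with h3 | h3
    · nlinarith [mul_self_nonneg t]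
    · exact hx0 h3

theorem IsModel.finrank_eq {e : g ≃ₗ[ℝ] (Fin 6 → ℝ)} {ε c : ℝ} (_ : IsModel e ε c) :
    Module.finrank ℝ g = 6 := by
  rw [e.finrank_eq]; simp

theorem IsModel.isNilpotent {e : g ≃ₗ[ℝ] (Fin 6 → ℝ)} {ε c : ℝ} (h : IsModel e ε c) :
    LieRing.IsNilpotent g := by
  have : Module.Finite ℝ g := Module.Finite.equiv e.symm
  -- By Engel's theorem it suffices that each ad x is nilpotent. Its successive images lie in the
  -- spans of Y, JY, C, JC, then Y, JY, C, then C, then 0, whence the exponent 4.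
  rw [LieAlgebra.isNilpotent_iff_forall (R := ℝ)]
  intro x
  refine ⟨4, LinearMap.ext fun y => e.injective ?_⟩
  simp only [pow_succ, pow_zero, one_mul, Module.End.mul_apply, LieAlgebra.ad_apply, h _ _,
    LinearMap.zero_apply, map_zero]
  funext i
  fin_cases i <;> simp [modelBracket]

/-- The invariant is the identity (ad x)³ = 0. It holds for ε = 0, but for ε = 1 one has (ad X)³ JX
= c'C. -/
theorem IsModel.isEmpty_lieEquiv {e : g ≃ₗ[ℝ] (Fin 6 → ℝ)} {e' : g' ≃ₗ[ℝ] (Fin 6 → ℝ)} {c c' : ℝ}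
    (h : IsModel e 0 c) (h' : IsModel e' 1 c') (hc' : c' ≠ 0) : IsEmpty (g ≃ₗ⁅ℝ⁆ g') := by
  refine ⟨fun A => ?_⟩
  have h0 : ∀ x y : g, ⁅x, ⁅x, ⁅x, y⁆⁆⁆ = 0 := by
    intro x y
    apply e.injective
    simp only [h _ _, map_zero]
    funext i
    fin_cases i <;> simp [modelBracket]
  have h1 := h0 (A.symm (e'.symm (Pi.single 0 1))) (A.symm (e'.symm (Pi.single 1 1)))
  simp only [← LieEquiv.map_lie] at h1
  have h2 : ⁅e'.symm (Pi.single 0 1), ⁅e'.symm (Pi.single 0 1),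
      ⁅e'.symm (Pi.single 0 1), e'.symm (Pi.single 1 1)⁆⁆⁆ = 0 := by
    simpa using congrArg A h1
  have h3 := congrFun (congrArg e' h2) 4
  simp [h' _ _, modelBracket, hc'] at h3

/-- For central z the left side of [x, [x, Jz]] = c(x₀² + x₁²)z does not involve coordinates.
Comparing both coordinate systems at one x with x₀ = 1, x₁ = 0 shows that c and c' have the same
sign. -/
theorem IsAdapted.sign_unique {e e' : g ≃ₗ[ℝ] (Fin 6 → ℝ)} {ε ε' c c' : ℝ} {J : g →ₗ[ℝ] g}
    (h : IsModel e ε c) (hJ : IsAdapted e J) (h' : IsModel e' ε' c') (hJ' : IsAdapted e' J)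
    (hc : c = 1 ∨ c = -1) (hc' : c' = 1 ∨ c' = -1) : c = c' := by
  have aux : ∀ {e : g ≃ₗ[ℝ] (Fin 6 → ℝ)} {ε c : ℝ}, IsModel e ε c → IsAdapted e J → c ≠ 0 →
      ∀ z : g, (∀ y : g, ⁅z, y⁆ = 0) → ∀ x, ⁅x, ⁅x, J z⁆⁆ = (c * (e x 0 ^ 2 + e x 1 ^ 2)) • z := by
    intro e ε c h hJ hc z hz x
    have hz' := h.apply_eq_of_central hc hz
    apply e.injective
    rw [h, h, hJ, map_smul, hz']
    funext i
    fin_cases i <;> simp [modelBracket, modelJ_apply] <;> ring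
  set z : g := e.symm (Pi.single 4 1) with hz
  have hz0 : z ≠ 0 := by
    intro hz0
    have := congrFun (congrArg e hz0) 4
    simp [hz] at this
  have hcen : ∀ y : g, ⁅z, y⁆ = 0 := by
    intro y
    apply e.injective
    rw [h, hz]
    funext i
    fin_cases i <;> simp [modelBracket]
  have hcne : c ≠ 0 := by rcases hc with rfl | rfl <;> norm_num
  have hcne' : c' ≠ 0 := by rcases hc' with rfl | rfl <;> norm_num
  have h1 := aux h hJ hcne z hcen (e.symm (Pi.single 0 1))
  rw [aux h' hJ' hcne' z hcen (e.symm (Pi.single 0 1))] at h1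
  have h2 := smul_left_injective ℝ hz0 h1
  simp at h2
  rcases hc with rfl | rfl <;> rcases hc' with rfl | rfl <;> first | rfl | nlinarith

/-- Coordinates identifying `(0, 0, 0, 12, 23, 14 - 35)` with the model algebra for `ε = 0`. -/
def coordsH19m {c : ℝ} (hc : c * c = 1) : (Fin 6 → ℝ) ≃ₗ[ℝ] (Fin 6 → ℝ) where
  toFun a := ![a 0, a 2, a 3, -a 4, c * a 5, a 1]
  invFun a := ![a 0, a 5, a 1, a 2, -a 3, c * a 4]
  map_add' a b := by
    funext i
    fin_cases i <;> simp <;> ring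
  map_smul' t a := by
    funext i
    fin_cases i <;> simp
    ring
  left_inv a := by
    funext i
    fin_cases i <;> simp [← mul_assoc, hc]
  right_inv a := by
    funext i
    fin_cases i <;> simp [← mul_assoc, hc]

theorem exists_isModel_H19m {c : ℝ} (hc : c * c = 1) :
    ∃ e : H19m ≃ₗ[ℝ] (Fin 6 → ℝ), IsModel e 0 c := by
  refine ⟨coordsH19m hc, fun x y => ?_⟩
  change (fun a : Fin 6 → ℝ => ![a 0, a 2, a 3, -a 4, c * a 5, a 1]) (H19m.bracket x y) =
    modelBracket 0 c ![x 0, x 2, x 3, -x 4, c * x 5, x 1] ![y 0, y 2, y 3, -y 4, c * y 5, y 1]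
  funext i
  fin_cases i <;> simp [H19m.bracket, modelBracket] <;> ring

/-- Coordinates identifying `(0, 0, 12, 13, 23, 14 + 25)` with the model algebra for `ε = 1`. -/
def coordsH26p {c : ℝ} (hc : c * c = 1) : (Fin 6 → ℝ) ≃ₗ[ℝ] (Fin 6 → ℝ) where
  toFun a := ![a 0, a 1, -a 3, -a 4, -(c * a 5), -a 2]
  invFun a := ![a 0, a 1, -a 5, -a 2, -a 3, -(c * a 4)]
  map_add' a b := by
    funext i
    fin_cases i <;> simp <;> ring
  map_smul' t a := by
    funext i
    fin_cases i <;> simp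
    ring
  left_inv a := by
    funext i
    fin_cases i <;> simp [← mul_assoc, hc]
  right_inv a := by
    funext i
    fin_cases i <;> simp [← mul_assoc, hc]

theorem exists_isModel_H26p {c : ℝ} (hc : c * c = 1) :
    ∃ e : H26p ≃ₗ[ℝ] (Fin 6 → ℝ), IsModel e 1 c := by
  refine ⟨coordsH26p hc, fun x y => ?_⟩
  change (fun a : Fin 6 → ℝ => ![a 0, a 1, -a 3, -a 4, -(c * a 5), -a 2]) (H26p.bracket x y) =
    modelBracket 1 c ![x 0, x 1, -x 3, -x 4, -(c * x 5), -x 2]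
      ![y 0, y 1, -y 3, -y 4, -(c * y 5), -y 2]
  funext i
  fin_cases i <;> simp [H26p.bracket, modelBracket] <;>
    first | ring1 | exact Or.inl (by ring)

end Model

/-! ### Forms of type (1,0) and reduced structure equations -/

section Forms10

variable {g : Type*} [LieRing g] [LieAlgebra ℝ g]

theorem apply_J_of_mem_forms10 {J : g →ₗ[ℝ] g} {ω : g →ₗ[ℝ] ℂ} (h : ω ∈ forms10 J) (X : g) :
    ω (J X) = -(Complex.I * ω X) := by
  have : -ω (J X) = Complex.I * ω X := h X
  rw [← this, neg_neg]

/-- The form of type `(1,0)` whose real part is a given real form. -/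
def formOfRe (J : g →ₗ[ℝ] g) (f : g →ₗ[ℝ] ℝ) : g →ₗ[ℝ] ℂ where
  toFun X := f X + f (J X) * Complex.I
  map_add' X Y := by
    simp only [map_add, Complex.ofReal_add]; ring
  map_smul' t X := by
    simp only [map_smul, smul_eq_mul, Complex.ofReal_mul, RingHom.id_apply, Complex.real_smul]
    ring

theorem formOfRe_mem {J : g →ₗ[ℝ] g} (hJ : ∀ X, J (J X) = -X) (f : g →ₗ[ℝ] ℝ) :
    formOfRe J f ∈ forms10 J := by
  intro X
  simp only [formOfRe, LinearMap.coe_mk, AddHom.coe_mk, hJ, map_neg, Complex.ofReal_neg]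
  linear_combination (-(f (J X) : ℂ)) * Complex.I_sq

/-- Every real functional is the real part of a form of type (1,0), and real functionals separate
points. -/
theorem eq_zero_of_forms10 {J : g →ₗ[ℝ] g} (hJ : ∀ X, J (J X) = -X) {X : g}
    (h : ∀ ω ∈ forms10 J, ω X = 0) : X = 0 := by
  rw [← Module.forall_dual_apply_eq_zero_iff ℝ]
  intro f
  simpa [formOfRe] using congrArg Complex.re (h _ (formOfRe_mem hJ f))

/-- A (1,0)-form satisfies ω(Jv) = -iω(v), so one value on each J-stable coordinate plane determines
it. -/
theorem forms10_ext {J : g →ₗ[ℝ] g} {e : g ≃ₗ[ℝ] (Fin 6 → ℝ)} (he : IsAdapted e J)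
    {ω ω' : g →ₗ[ℝ] ℂ} (h : ω ∈ forms10 J) (h' : ω' ∈ forms10 J)
    (h0 : ω (e.symm (Pi.single 0 1)) = ω' (e.symm (Pi.single 0 1)))
    (h2 : ω (e.symm (Pi.single 2 1)) = ω' (e.symm (Pi.single 2 1)))
    (h5 : ω (e.symm (Pi.single 5 1)) = ω' (e.symm (Pi.single 5 1))) : ω = ω' := by
  have key : ∀ i j : Fin 6, modelJ (Pi.single i 1) = Pi.single j 1 →
      ω (e.symm (Pi.single i 1)) = ω' (e.symm (Pi.single i 1)) →
      ω (e.symm (Pi.single j 1)) = ω' (e.symm (Pi.single j 1)) := by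
    intro i j hij hi
    have : e.symm (Pi.single j 1) = J (e.symm (Pi.single i 1)) := by
      apply e.injective
      rw [he, e.apply_symm_apply, e.apply_symm_apply, hij]
    rw [this, apply_J_of_mem_forms10 h, apply_J_of_mem_forms10 h', hi]
  have key' : ω (e.symm (Pi.single 4 1)) = ω' (e.symm (Pi.single 4 1)) := by
    have : e.symm (Pi.single 4 1) = -J (e.symm (Pi.single 5 1)) := by
      apply e.injective
      rw [map_neg, he, e.apply_symm_apply, e.apply_symm_apply]
      funext i
      fin_cases i <;> simp [modelJ_apply]
    rw [this, map_neg, map_neg, apply_J_of_mem_forms10 h, apply_J_of_mem_forms10 h', h5]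
  have h1 := key 0 1 (by funext i; fin_cases i <;> simp [modelJ_apply]) h0
  have h3 := key 2 3 (by funext i; fin_cases i <;> simp [modelJ_apply]) h2
  have : ω ∘ₗ e.symm.toLinearMap = ω' ∘ₗ e.symm.toLinearMap := by
    refine LinearMap.pi_ext' fun i => LinearMap.ext_ring ?_
    fin_cases i
    exacts [h0, h1, h2, h3, key', h5]
  ext x
  simpa using LinearMap.congr_fun this (e x)

/-- The form `(p(e x) + i q(e x)) / 2` for two real forms `p` and `q` in coordinates. -/
noncomputable def halfForm (e : g ≃ₗ[ℝ] (Fin 6 → ℝ)) (p q : (Fin 6 → ℝ) →ₗ[ℝ] ℝ) :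
    g →ₗ[ℝ] ℂ where
  toFun x := (p (e x) + q (e x) * Complex.I) / 2
  map_add' X Y := by
    simp only [map_add, Complex.ofReal_add]; ring
  map_smul' t X := by
    simp only [map_smul, smul_eq_mul, Complex.ofReal_mul, RingHom.id_apply, Complex.real_smul]
    ring

/-- The forms of type `(1,0)` dual to adapted coordinates. -/
noncomputable def adaptedForm (e : g ≃ₗ[ℝ] (Fin 6 → ℝ)) : Fin 3 → g →ₗ[ℝ] ℂ :=
  ![halfForm e (LinearMap.proj 0) (-LinearMap.proj 1),
    halfForm e (LinearMap.proj 2) (-LinearMap.proj 3),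
    halfForm e (LinearMap.proj 5) (LinearMap.proj 4)]

theorem adaptedForm_apply (e : g ≃ₗ[ℝ] (Fin 6 → ℝ)) (x : g) :
    adaptedForm e 0 x = (e x 0 - e x 1 * Complex.I) / 2 ∧
    adaptedForm e 1 x = (e x 2 - e x 3 * Complex.I) / 2 ∧
    adaptedForm e 2 x = (e x 5 + e x 4 * Complex.I) / 2 := by
  simp [adaptedForm, halfForm, sub_eq_add_neg]

theorem adaptedForm_mem {J : g →ₗ[ℝ] g} {e : g ≃ₗ[ℝ] (Fin 6 → ℝ)} (he : IsAdapted e J)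
    (i : Fin 3) : adaptedForm e i ∈ forms10 J := by
  have := fun x => adaptedForm_apply e x
  intro x
  fin_cases i
  · simp [this, he _, modelJ_apply]
    linear_combination ((e x 1 : ℂ) / 2) * Complex.I_sq
  · simp [this, he _, modelJ_apply]
    linear_combination ((e x 3 : ℂ) / 2) * Complex.I_sq
  · simp [this, he _, modelJ_apply]
    linear_combination (-(e x 4 : ℂ) / 2) * Complex.I_sq

/-- The basis of the forms of type `(1,0)` dual to adapted coordinates. -/
theorem exists_basis_adaptedForm {J : g →ₗ[ℝ] g} {e : g ≃ₗ[ℝ] (Fin 6 → ℝ)}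
    (he : IsAdapted e J) :
    ∃ b : Module.Basis (Fin 3) ℂ (forms10 J), ∀ i, (b i : g →ₗ[ℝ] ℂ) = adaptedForm e i := by
  set v : Fin 3 → forms10 J := fun i => ⟨adaptedForm e i, adaptedForm_mem he i⟩ with hv
  have hval : ∀ (w : Fin 3 → ℂ) (x : g), ((∑ i, w i • v i : forms10 J) : g →ₗ[ℝ] ℂ) x =
      w 0 * ((e x 0 - e x 1 * Complex.I) / 2) + w 1 * ((e x 2 - e x 3 * Complex.I) / 2) +
        w 2 * ((e x 5 + e x 4 * Complex.I) / 2) := by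
    intro w x
    simp [Fin.sum_univ_three, hv, adaptedForm_apply]
  have hli : LinearIndependent ℂ v := by
    rw [Fintype.linearIndependent_iff]
    intro w hw
    have key : ∀ x, ((∑ i, w i • v i : forms10 J) : g →ₗ[ℝ] ℂ) x = 0 := by
      intro x; rw [hw]; rfl
    simp only [hval] at key
    have h0 := key (e.symm (Pi.single 0 1))
    have h1 := key (e.symm (Pi.single 2 1))
    have h2 := key (e.symm (Pi.single 5 1))
    simp at h0 h1 h2
    intro i
    fin_cases i
    exacts [h0, h1, h2]
  have hsp : ⊤ ≤ Submodule.span ℂ (Set.range v) := by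
    rintro ⟨ω, hω⟩ -
    have : (⟨ω, hω⟩ : forms10 J) = ∑ i, ![2 * ω (e.symm (Pi.single 0 1)),
        2 * ω (e.symm (Pi.single 2 1)), 2 * ω (e.symm (Pi.single 5 1))] i • v i := by
      apply Subtype.ext
      refine forms10_ext he hω (Subtype.property _) ?_ ?_ ?_
      all_goals rw [hval]; simp; ring
    rw [this]
    exact Submodule.sum_mem _ fun i _ => Submodule.smul_mem _ _ (Submodule.subset_span ⟨i, rfl⟩)
  exact ⟨Module.Basis.mk hli hsp, fun i => by rw [Module.Basis.mk_apply]⟩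

theorem IsModel.hasReducedBasis {e : g ≃ₗ[ℝ] (Fin 6 → ℝ)} {ε c : ℝ} (h : IsModel e ε c)
    {J : g →ₗ[ℝ] g} (hJ : IsAdapted e J) : HasReducedBasis J ε c := by
  obtain ⟨b, hb⟩ := exists_basis_adaptedForm hJ
  refine ⟨b, _, _, _, rfl, rfl, rfl, ?_⟩
  simp only [hb]
  have r0 : ∀ x, (adaptedForm e 0 x).re = e x 0 / 2 ∧ (adaptedForm e 0 x).im = -e x 1 / 2 := by
    simp [adaptedForm_apply, neg_div]
  have r1 : ∀ x, (adaptedForm e 1 x).re = e x 2 / 2 ∧ (adaptedForm e 1 x).im = -e x 3 / 2 := by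
    simp [adaptedForm_apply, neg_div]
  have r2 : ∀ x, (adaptedForm e 2 x).re = e x 5 / 2 ∧ (adaptedForm e 2 x).im = e x 4 / 2 := by
    simp [adaptedForm_apply]
  refine ⟨?_, ?_, ?_⟩ <;> funext x y <;> apply Complex.ext
  all_goals simp [d, wedge, conj, r0, r1, r2, h _ _, modelBracket]
  all_goals ring

/-- Real coordinates attached to a triple of complex forms. -/
noncomputable def coordsOfForms (ω₁ ω₂ ω₃ : g →ₗ[ℝ] ℂ) : g →ₗ[ℝ] (Fin 6 → ℝ) where
  -- The factor 2 absorbs ω³ + ω̄³ = 2 Re ω³. In the last pair Re ω³ belongs to JC and Im ω³ to C,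
  -- so the order is reversed.
  toFun x := ![2 * (ω₁ x).re, -2 * (ω₁ x).im, 2 * (ω₂ x).re, -2 * (ω₂ x).im,
    2 * (ω₃ x).im, 2 * (ω₃ x).re]
  map_add' x y := by
    funext i
    fin_cases i <;> simp <;> ring
  map_smul' t x := by
    funext i
    fin_cases i <;> simp <;> ring

/-- A vector killed by the basis is killed by all (1,0)-forms, hence zero; by dimension the real and
imaginary parts are coordinates. In these the structure equations are the model bracket. -/
theorem HasReducedBasis.exists_isModel {J : g →ₗ[ℝ] g} (hJ : ∀ X, J (J X) = -X)
    (hg : Module.finrank ℝ g = 6) {ε c : ℝ} (h : HasReducedBasis J ε c) :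
    ∃ e : g ≃ₗ[ℝ] (Fin 6 → ℝ), IsModel e ε c ∧ IsAdapted e J := by
  obtain ⟨b, ω₁, ω₂, ω₃, h1, h2, h3, d1, d2, d3⟩ := h
  have : Module.Finite ℝ g := Module.finite_of_finrank_pos (by omega)
  have hinj : Function.Injective (coordsOfForms ω₁ ω₂ ω₃) := by
    rw [injective_iff_map_eq_zero]
    intro x hx
    have hx' : ∀ i, coordsOfForms ω₁ ω₂ ω₃ x i = 0 := fun i => congrFun hx i
    have z1 : ω₁ x = 0 := by
      have a := hx' 0; have b := hx' 1
      simp [coordsOfForms] at a b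
      exact Complex.ext a b
    have z2 : ω₂ x = 0 := by
      have a := hx' 2; have b := hx' 3
      simp [coordsOfForms] at a b
      exact Complex.ext a b
    have z3 : ω₃ x = 0 := by
      have a := hx' 5; have b := hx' 4
      simp [coordsOfForms] at a b
      exact Complex.ext a b
    refine eq_zero_of_forms10 hJ fun ω hω => ?_
    have hsum := b.sum_repr ⟨ω, hω⟩
    rw [Fin.sum_univ_three] at hsum
    have hsum' := congrArg (fun w : forms10 J => (w : g →ₗ[ℝ] ℂ) x) hsum
    simp only [Submodule.coe_add, Submodule.coe_smul, ← h1, ← h2, ← h3, LinearMap.add_apply,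
      LinearMap.smul_apply, z1, z2, z3, smul_zero, add_zero] at hsum'
    exact hsum'.symm
  let e := LinearMap.linearEquivOfInjective (coordsOfForms ω₁ ω₂ ω₃) hinj (by simp [hg])
  have he : ∀ x, e x = ![2 * (ω₁ x).re, -2 * (ω₁ x).im, 2 * (ω₂ x).re, -2 * (ω₂ x).im,
    2 * (ω₃ x).im, 2 * (ω₃ x).re] := fun x => rfl
  have m1 : ω₁ ∈ forms10 J := h1 ▸ (b 0).2
  have m2 : ω₂ ∈ forms10 J := h2 ▸ (b 1).2
  have m3 : ω₃ ∈ forms10 J := h3 ▸ (b 2).2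
  refine ⟨e, fun x y => ?_, fun x => ?_⟩
  · have k1 : ω₁ ⁅x, y⁆ = 0 := by
      simpa [d] using congrFun (congrFun d1 x) y
    have k2 := neg_eq_iff_eq_neg.mp (congrFun (congrFun d2 x) y)
    have k3 := neg_eq_iff_eq_neg.mp (congrFun (congrFun d3 x) y)
    rw [he, he, he, k1, k2, k3]
    funext i
    fin_cases i <;> simp [modelBracket, wedge, conj] <;> ring
  · rw [he, he, apply_J_of_mem_forms10 m1, apply_J_of_mem_forms10 m2, apply_J_of_mem_forms10 m3]
    funext i
    fin_cases i <;> simp [modelJ_apply]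

end Forms10

/-! ### Consequences of nilpotency -/

section Nilpotent

variable {g : Type*} [LieRing g] [LieAlgebra ℝ g]

/-- The subspace spanned by the brackets with elements of a subspace. -/
def bracketSpan (W : Submodule ℝ g) : Submodule ℝ g :=
  Submodule.span ℝ {m | ∃ x : g, ∃ k ∈ W, ⁅x, k⁆ = m}

theorem lie_mem_bracketSpan {W : Submodule ℝ g} (x : g) {k : g} (hk : k ∈ W) :
    ⁅x, k⁆ ∈ bracketSpan W :=
  Submodule.subset_span ⟨x, k, hk, rfl⟩

/-- Iterating W ⊆ [g, W] + I pushes W, modulo I, into every term of the lower central series, hence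
into 0. -/
theorem le_of_le_bracketSpan_sup [LieRing.IsNilpotent g] {W I : Submodule ℝ g}
    (hI : ∀ x : g, ∀ k ∈ I, ⁅x, k⁆ ∈ I) (hW : W ≤ bracketSpan W ⊔ I) : W ≤ I := by
  obtain ⟨n, hn⟩ := LieModule.IsNilpotent.nilpotent ℝ g g
  have key : ∀ n, W ≤ (LieModule.lowerCentralSeries ℝ g g n).toSubmodule ⊔ I := by
    intro n
    induction n with
    | zero => simp
    | succ n ih =>
      refine hW.trans (sup_le (Submodule.span_le.mpr ?_) le_sup_right)
      rintro _ ⟨x, k, hk, rfl⟩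
      obtain ⟨a, ha, b, hb, rfl⟩ := Submodule.mem_sup.mp (ih hk)
      rw [lie_add]
      refine Submodule.add_mem_sup ?_ (hI x b hb)
      rw [LieSubmodule.mem_toSubmodule, LieModule.lowerCentralSeries_succ]
      exact LieSubmodule.lie_mem_lie (LieSubmodule.mem_top x) ha
  have := key n
  rwa [hn, LieSubmodule.bot_toSubmodule, bot_sup_eq] at this

theorem eq_zero_of_subset_bracketSpan [LieRing.IsNilpotent g] {S : Set g}
    (hS : S ⊆ bracketSpan (Submodule.span ℝ S)) {x : g} (hx : x ∈ S) : x = 0 := by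
  have : Submodule.span ℝ S ≤ ⊥ := by
    refine le_of_le_bracketSpan_sup (fun x k hk => ?_) ?_
    · rw [(Submodule.mem_bot ℝ).mp hk, lie_zero]; exact zero_mem _
    · rw [sup_bot_eq, Submodule.span_le]; exact hS
  exact (Submodule.mem_bot ℝ).mp (this (Submodule.subset_span hx))

/-- Modulo the ideal, w is an eigenvector of ad x with nonzero eigenvalue, so the line of w lies in
its own bracket span plus I. -/
theorem mem_of_lie_sub_smul_mem [LieRing.IsNilpotent g] {I : Submodule ℝ g}
    (hI : ∀ x : g, ∀ k ∈ I, ⁅x, k⁆ ∈ I) {x w : g} {t : ℝ} (ht : t ≠ 0)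
    (h : ⁅x, w⁆ - t • w ∈ I) : w ∈ I := by
  have : Submodule.span ℝ {w} ≤ I := by
    refine le_of_le_bracketSpan_sup hI ?_
    rw [Submodule.span_le, Set.singleton_subset_iff]
    have hw : w = t⁻¹ • ⁅x, w⁆ + (-t⁻¹) • (⁅x, w⁆ - t • w) := by
      rw [smul_sub, smul_smul, neg_mul, inv_mul_cancel₀ ht]
      module
    rw [SetLike.mem_coe, hw]
    refine Submodule.add_mem_sup (Submodule.smul_mem _ _ ?_) (Submodule.smul_mem _ _ h)
    rw [← hw]
    exact lie_mem_bracketSpan x (Submodule.mem_span_singleton_self w)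
  exact this (Submodule.mem_span_singleton_self w)

theorem eq_zero_of_lie_eq_smul [LieRing.IsNilpotent g] {x w : g} {t : ℝ} (ht : t ≠ 0)
    (h : ⁅x, w⁆ = t • w) : w = 0 := by
  have : w ∈ (⊥ : Submodule ℝ g) := by
    refine mem_of_lie_sub_smul_mem (fun x k hk => ?_) ht (x := x) ?_
    · rw [(Submodule.mem_bot ℝ).mp hk, lie_zero]; exact zero_mem _
    · rw [h, sub_self]; exact zero_mem _
  exact (Submodule.mem_bot ℝ).mp this

end Nilpotent

/-! ### Linear algebra with J -/

section AlmostComplex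

variable {V : Type*} [AddCommGroup V] [Module ℝ V]

theorem eq_zero_of_add_smul_eq_zero {J : V →ₗ[ℝ] V} (hJ : ∀ x, J (J x) = -x) {v : V}
    (hv : v ≠ 0) {a b : ℝ} (h : a • v + b • J v = 0) : a = 0 ∧ b = 0 := by
  have h1 : J (a • v + b • J v) = 0 := by rw [h, map_zero]
  rw [map_add, map_smul, map_smul, hJ] at h1
  have h2 : (a ^ 2 + b ^ 2) • v = 0 := by
    have : (a ^ 2 + b ^ 2) • v = a • (a • v + b • J v) - b • (a • J v + b • -v) := by module
    rw [this, h, h1, smul_zero, smul_zero, sub_zero]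
  have h3 := (smul_eq_zero.mp h2).resolve_right hv
  constructor <;> nlinarith [sq_nonneg a, sq_nonneg b]

/-- This inverts the complex number a + ib acting on the pair v, v' = Jv; B itself need not be
J-stable. -/
theorem mem_of_add_smul_mem {B : Submodule ℝ V} {v v' : V} {a b : ℝ}
    (h : a • v + b • v' ∈ B) (h' : a • v' - b • v ∈ B) (hab : a ≠ 0 ∨ b ≠ 0) :
    v ∈ B ∧ v' ∈ B := by
  have h0 : a ^ 2 + b ^ 2 ≠ 0 := by
    rcases hab with h | h
    · positivity
    · positivity
  have e1 : v = (a ^ 2 + b ^ 2)⁻¹ • (a • (a • v + b • v') - b • (a • v' - b • v)) := by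
    rw [show a • (a • v + b • v') - b • (a • v' - b • v) = (a ^ 2 + b ^ 2) • v by module,
      smul_smul, inv_mul_cancel₀ h0, one_smul]
  have e2 : v' = (a ^ 2 + b ^ 2)⁻¹ • (b • (a • v + b • v') + a • (a • v' - b • v)) := by
    rw [show b • (a • v + b • v') + a • (a • v' - b • v) = (a ^ 2 + b ^ 2) • v' by module,
      smul_smul, inv_mul_cancel₀ h0, one_smul]
  constructor
  · rw [e1]
    exact B.smul_mem _ (B.sub_mem (B.smul_mem _ h) (B.smul_mem _ h'))
  · rw [e2]
    exact B.smul_mem _ (B.add_mem (B.smul_mem _ h) (B.smul_mem _ h'))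

end AlmostComplex

/-! ### The frame X, JX, Y, JY, C, JC and the dimension bound -/

section Core

variable {g : Type*} [LieRing g] [LieAlgebra ℝ g] {J : g →ₗ[ℝ] g}

theorem IsComplexStructure.lie_J_J (hJ : IsComplexStructure J) {C : g}
    (hC : ∀ z : g, ⁅C, z⁆ = 0) (z : g) : ⁅J C, J z⁆ = J ⁅J C, z⁆ := by
  rw [hJ.nijenhuis, hC, hC, map_zero, add_zero, add_zero]

/-- The linear map `a ↦ a₀ X + a₁ JX + a₂ Y + a₃ JY + a₄ C + a₅ JC` with `Y = [JC, X]`. -/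
def frameMap (J : g →ₗ[ℝ] g) (X C : g) : (Fin 6 → ℝ) →ₗ[ℝ] g :=
  Fintype.linearCombination ℝ ![X, J X, ⁅J C, X⁆, J ⁅J C, X⁆, C, J C]

theorem frameMap_apply (X C : g) (a : Fin 6 → ℝ) : frameMap J X C a =
    a 0 • X + a 1 • J X + a 2 • ⁅J C, X⁆ + a 3 • J ⁅J C, X⁆ + a 4 • C + a 5 • J C := by
  simp [frameMap, Fintype.linearCombination_apply, Fin.sum_univ_six]

theorem IsComplexStructure.frameMap_injective [LieRing.IsNilpotent g] (hJ : IsComplexStructure J)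
    {X C : g} (hC : ∀ z : g, ⁅C, z⁆ = 0) (hY : ⁅J C, X⁆ ≠ 0) (hDY : ⁅J C, ⁅J C, X⁆⁆ = 0) :
    Function.Injective (frameMap J X C) := by
  have hDJ := hJ.lie_J_J hC
  have hC' : ∀ z : g, ⁅z, C⁆ = 0 := fun z => by rw [← lie_skew, hC, neg_zero]
  have hC0 : C ≠ 0 := by
    rintro rfl
    simp at hY
  -- The image of D = ad(JC) meets span(C, JC) only in 0: since D commutes with J, a nonzero common
  -- vector would put JC itself in the image, and JC would be an eigenvector of some ad with nonzero
  -- eigenvalue.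
  have hCC : ∀ (Z : g) (α β : ℝ), ⁅J C, Z⁆ = α • C + β • J C → α = 0 ∧ β = 0 := by
    intro Z α β h
    by_contra hαβ
    have h0 : α ^ 2 + β ^ 2 ≠ 0 := by
      intro h0
      apply hαβ
      constructor <;> nlinarith [sq_nonneg α, sq_nonneg β]
    have h1 : ⁅J C, β • Z + α • J Z⁆ = (α ^ 2 + β ^ 2) • J C := by
      rw [lie_add, lie_smul, lie_smul, hDJ, h, map_add, map_smul, map_smul, hJ.sq_eq]
      module
    have h2 : J C = 0 := by
      refine eq_zero_of_lie_eq_smul (x := β • Z + α • J Z) (neg_ne_zero.mpr h0) ?_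
      rw [← lie_skew, h1, neg_smul]
    exact hC0 (by simpa [hJ.sq_eq] using congrArg J h2)
  rw [injective_iff_map_eq_zero]
  intro a ha
  rw [frameMap_apply] at ha
  have h01 : a 0 = 0 ∧ a 1 = 0 := by
    apply eq_zero_of_add_smul_eq_zero hJ.sq_eq hY
    have := congrArg (fun z => ⁅J C, z⁆) ha
    simpa [hDJ, hDY, hC'] using this
  rw [h01.1, h01.2, zero_smul, zero_smul, zero_add, zero_add] at ha
  have h45 : -a 4 = 0 ∧ -a 5 = 0 := by
    apply hCC (a 2 • X + a 3 • J X)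
    rw [lie_add, lie_smul, lie_smul, hDJ, ← sub_eq_zero, ← ha]
    module
  have h4 := neg_eq_zero.mp h45.1
  have h5 := neg_eq_zero.mp h45.2
  rw [h4, h5, zero_smul, zero_smul, add_zero, add_zero] at ha
  have h23 := eq_zero_of_add_smul_eq_zero hJ.sq_eq hY ha
  funext i
  fin_cases i
  exacts [h01.1, h01.2, h23.1, h23.2, h4, h5]

/-- A nonzero central C exists by nilpotency, and JC is not central. In the chain X₀, DX₀, D²X₀, …
the vector two places before the first zero serves as X. -/
theorem exists_frame [LieRing.IsNilpotent g] [Nontrivial g]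
    (hZ : ∀ x : g, (∀ y : g, ⁅x, y⁆ = 0) → (∀ y : g, ⁅J x, y⁆ = 0) → x = 0) :
    ∃ X C : g, (∀ z : g, ⁅C, z⁆ = 0) ∧ ⁅J C, X⁆ ≠ 0 ∧ ⁅J C, ⁅J C, X⁆⁆ = 0 := by
  obtain ⟨⟨C, hCmem⟩, hC0⟩ :=
    @exists_ne _ (LieAlgebra.non_trivial_center_of_isNilpotent (R := ℝ) (L := g)) 0
  have hC0' : C ≠ 0 := fun h => hC0 (Subtype.ext h)
  have hC' : ∀ z : g, ⁅z, C⁆ = 0 := hCmem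
  have hC : ∀ z : g, ⁅C, z⁆ = 0 := fun z => by rw [← lie_skew, hC', neg_zero]
  obtain ⟨X₀, hX₀⟩ : ∃ X₀ : g, ⁅J C, X₀⁆ ≠ 0 := by
    by_contra! h
    exact hC0' (hZ C hC h)
  obtain ⟨k, hk⟩ := LieAlgebra.nilpotent_ad_of_nilpotent_algebra ℝ g
  have hex : ∃ k, ((LieAlgebra.ad ℝ g (J C)) ^ k) X₀ = 0 := ⟨k, by rw [hk]; rfl⟩
  classical
  obtain ⟨m, hm⟩ : ∃ m, Nat.find hex = m + 2 := by
    have h0 := Nat.find_spec hex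
    rcases h : Nat.find hex with _ | _ | m
    · rw [h] at h0
      rw [show X₀ = 0 from h0, lie_zero] at hX₀
      exact absurd rfl hX₀
    · rw [h] at h0
      exact absurd (by simpa using h0) hX₀
    · exact ⟨m, rfl⟩
  refine ⟨((LieAlgebra.ad ℝ g (J C)) ^ m) X₀, C, hC, ?_, ?_⟩
  · have := Nat.find_min hex (m := m + 1) (by omega)
    rwa [pow_succ', Module.End.mul_apply] at this
  · have := Nat.find_spec hex
    rw [hm, pow_succ', pow_succ', Module.End.mul_apply, Module.End.mul_apply] at this
    exact this

theorem IsComplexStructure.six_le_finrank [Module.Finite ℝ g] [LieRing.IsNilpotent g]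
    [Nontrivial g] (hJ : IsComplexStructure J)
    (hZ : ∀ x : g, (∀ y : g, ⁅x, y⁆ = 0) → (∀ y : g, ⁅J x, y⁆ = 0) → x = 0) :
    6 ≤ Module.finrank ℝ g := by
  obtain ⟨X, C, hC, hY, hDY⟩ := exists_frame hZ
  simpa using LinearMap.finrank_le_finrank_of_injective (hJ.frameMap_injective hC hY hDY)

/-! ### Non-nilpotency as a condition on the centre -/

theorem ascendingSeries_le_succ (J : g →ₗ[ℝ] g) (l : ℕ) :
    ascendingSeries J l ≤ ascendingSeries J (l + 1) := by
  induction l with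
  | zero => exact bot_le
  | succ l ih => exact fun X hX Y => ⟨ih (hX Y).1, ih (hX Y).2⟩

theorem J_mem_ascendingSeries (hJ : ∀ x, J (J x) = -x) (l : ℕ) {X : g}
    (hX : X ∈ ascendingSeries J l) : J X ∈ ascendingSeries J l := by
  cases l with
  | zero => rw [show X = 0 from hX, map_zero]; exact zero_mem _
  | succ l =>
    intro Y
    refine ⟨(hX Y).2, ?_⟩
    rw [hJ, neg_lie]
    exact neg_mem (hX Y).1

/-- The terms of the ascending series as ideals. -/
def ascendingIdeal (J : g →ₗ[ℝ] g) (l : ℕ) : LieIdeal ℝ g :=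
  { ascendingSeries J l with
    lie_mem := by
      intro x m hm
      have : ⁅m, x⁆ ∈ ascendingSeries J l := by
        exact ((ascendingSeries_le_succ J l hm) x).1
      rw [← lie_skew]
      exact (ascendingSeries J l).neg_mem this }

/-- The dimension bound is applied to the quotient by the stable term of the series. That term
contains x, so x ≠ 0 would make the quotient too small. -/
theorem IsNonNilpotentComplexStructure.eq_zero_of_central [LieRing.IsNilpotent g]
    (hg : Module.finrank ℝ g = 6) (hJ : IsNonNilpotentComplexStructure J) (x : g)
    (hx : ∀ y : g, ⁅x, y⁆ = 0) (hJx : ∀ y : g, ⁅J x, y⁆ = 0) : x = 0 := by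
  have : Module.Finite ℝ g := Module.finite_of_finrank_pos (by omega)
  by_contra hx0
  obtain ⟨hJ, htop⟩ := hJ
  have hmono : Monotone (ascendingSeries J) := monotone_nat_of_le_succ (ascendingSeries_le_succ J)
  obtain ⟨n, hn⟩ := monotone_stabilizes_iff_noetherian.mpr (inferInstance : IsNoetherian ℝ g)
    ⟨ascendingSeries J, hmono⟩
  have hn1 : ascendingSeries J n = ascendingSeries J (n + 1) := hn (n + 1) (by omega)
  have hxmem : x ∈ ascendingSeries J n := by
    rw [hn1]
    intro y
    rw [hx, hJx]
    exact ⟨zero_mem _, zero_mem _⟩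
  set I := ascendingIdeal J n with hI
  have hmem : ∀ z, z ∈ I ↔ z ∈ ascendingSeries J n := fun z => Iff.rfl
  have hmk : ∀ z : g, (LieSubmodule.Quotient.mk z : g ⧸ I) = 0 ↔ z ∈ ascendingSeries J n :=
    fun z => (LieSubmodule.Quotient.mk_eq_zero' (N := I) (m := z)).trans (hmem z)
  let Jq : (g ⧸ I) →ₗ[ℝ] (g ⧸ I) := Submodule.mapQ I.toSubmodule I.toSubmodule J
    fun z hz => J_mem_ascendingSeries hJ.sq_eq n hz
  have hJq : ∀ z : g, Jq (LieSubmodule.Quotient.mk z) = LieSubmodule.Quotient.mk (J z) :=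
    fun z => rfl
  have hbr : ∀ y z : g, (⁅LieSubmodule.Quotient.mk y, LieSubmodule.Quotient.mk z⁆ : g ⧸ I) =
      LieSubmodule.Quotient.mk ⁅y, z⁆ := fun y z => (LieSubmodule.Quotient.mk_bracket I y z).symm
  have hsurj : ∀ z : g ⧸ I, ∃ y : g, z = LieSubmodule.Quotient.mk y := by
    intro z
    obtain ⟨y, hy⟩ := LieSubmodule.Quotient.surjective_mk' I z
    exact ⟨y, hy.symm⟩
  have hJqc : IsComplexStructure Jq := by
    constructor
    · intro z
      obtain ⟨z, rfl⟩ := hsurj z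
      rw [hJq, hJq, hJ.sq_eq]
      rfl
    · intro y z
      obtain ⟨y, rfl⟩ := hsurj y
      obtain ⟨z, rfl⟩ := hsurj z
      simp only [hJq, hbr, hJ.nijenhuis]
      rfl
  have hnt : Nontrivial (g ⧸ I) := by
    by_contra hnt
    rw [not_nontrivial_iff_subsingleton] at hnt
    refine htop ⟨n, eq_top_iff.mpr fun z _ => ?_⟩
    rw [← hmk]
    exact Subsingleton.elim _ _
  have hnil : LieRing.IsNilpotent (g ⧸ I) :=
    Function.Surjective.lieAlgebra_isNilpotent (R := ℝ)
      (f := { (LieSubmodule.Quotient.mk' I : g →ₗ[ℝ] g ⧸ I) with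
        map_lie' := fun {y z} => (hbr y z).symm })
      (LieSubmodule.Quotient.surjective_mk' I)
  have h6 : 6 ≤ Module.finrank ℝ (g ⧸ I) := by
    -- If the classes of z and Jz are central in the quotient, then z lies in the next term of the
    -- series, which equals the current one.
    refine hJqc.six_le_finrank fun z hz hz' => ?_
    obtain ⟨z, rfl⟩ := hsurj z
    rw [hmk, hn1]
    intro y
    refine ⟨?_, ?_⟩
    · rw [← hmk, ← hbr, hz]
    · rw [← hmk, ← hbr, ← hJq, hz']
  have hsum : Module.finrank ℝ (g ⧸ I) + Module.finrank ℝ I.toSubmodule = Module.finrank ℝ g :=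
    Submodule.finrank_quotient_add_finrank I.toSubmodule
  have hpos : 0 < Module.finrank ℝ I.toSubmodule := by
    rw [Module.finrank_pos_iff_exists_ne_zero]
    exact ⟨⟨x, hxmem⟩, fun h => hx0 (congrArg Subtype.val h)⟩
  omega

end Core

/-! ### Determination of the brackets -/

section Structure

variable {g : Type*} [LieRing g] [LieAlgebra ℝ g] {J : g →ₗ[ℝ] g}

/-- With `Y = [JC, X]`, the vectors `X, JX, Y, JY, C, JC` satisfy the bracket relations of the
model up to the two constants in `[X, Y] = [JX, JY] = δ C` and the four coefficients of
`[X, JX] = p Y + q JY + r C + s JC`. -/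
structure IsFrame (J : g →ₗ[ℝ] g) (X C : g) (δ p q r s : ℝ) : Prop where
  central : ∀ z : g, ⁅C, z⁆ = 0
  lie_ne_zero : ⁅J C, X⁆ ≠ 0
  lie_lie : ⁅J C, ⁅J C, X⁆⁆ = 0
  lie_Y_JY : ⁅⁅J C, X⁆, J ⁅J C, X⁆⁆ = 0
  lie_X_Y : ⁅X, ⁅J C, X⁆⁆ = δ • C
  lie_X_JY : ⁅X, J ⁅J C, X⁆⁆ = 0
  lie_JX_Y : ⁅J X, ⁅J C, X⁆⁆ = 0
  lie_JX_JY : ⁅J X, J ⁅J C, X⁆⁆ = δ • C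
  lie_X_JX : ⁅X, J X⁆ = p • ⁅J C, X⁆ + q • J ⁅J C, X⁆ + r • C + s • J C

theorem IsComplexStructure.exists_isFrame [LieRing.IsNilpotent g]
    (hg : Module.finrank ℝ g = 6) (hJ : IsComplexStructure J)
    (hZ : ∀ x : g, (∀ y : g, ⁅x, y⁆ = 0) → (∀ y : g, ⁅J x, y⁆ = 0) → x = 0) :
    ∃ (X C : g) (δ p q r s : ℝ), δ ≠ 0 ∧ IsFrame J X C δ p q r s := by
  have : Module.Finite ℝ g := Module.finite_of_finrank_pos (by omega)
  have : Nontrivial g := Module.nontrivial_of_finrank_pos (R := ℝ) (by omega)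
  obtain ⟨X, C, hC, hY0, hDY⟩ := exists_frame hZ
  have hinj := hJ.frameMap_injective hC hY0 hDY
  have hsurj : ∀ z : g, ∃ a0 a1 a2 a3 a4 a5 : ℝ, z =
      a0 • X + a1 • J X + a2 • ⁅J C, X⁆ + a3 • J ⁅J C, X⁆ + a4 • C + a5 • J C := by
    intro z
    obtain ⟨a, rfl⟩ := (LinearMap.injective_iff_surjective_of_finrank_eq_finrank
      (by simp [hg])).mp hinj z
    exact ⟨_, _, _, _, _, _, frameMap_apply X C a⟩
  have hind : ∀ a0 a1 a2 a3 a4 a5 : ℝ,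
      a0 • X + a1 • J X + a2 • ⁅J C, X⁆ + a3 • J ⁅J C, X⁆ + a4 • C + a5 • J C = 0 →
      a0 = 0 ∧ a1 = 0 ∧ a2 = 0 ∧ a3 = 0 ∧ a4 = 0 ∧ a5 = 0 := by
    intro a0 a1 a2 a3 a4 a5 h
    have h1 : frameMap J X C ![a0, a1, a2, a3, a4, a5] = frameMap J X C 0 := by
      rw [map_zero, frameMap_apply]; exact h
    have h2 := fun i => congrFun (hinj h1) i
    exact ⟨h2 0, h2 1, h2 2, h2 3, h2 4, h2 5⟩
  have hC' : ∀ z : g, ⁅z, C⁆ = 0 := fun z => by rw [← lie_skew, hC, neg_zero]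
  have hDJ := hJ.lie_J_J hC
  have hJJ := hJ.sq_eq
  have hJXJY := hJ.nijenhuis X ⁅J C, X⁆
  obtain ⟨Y, hY⟩ : ∃ Y, Y = ⁅J C, X⁆ := ⟨_, rfl⟩
  have hDX : ⁅J C, X⁆ = Y := hY.symm
  have hDX1 : ⁅J C, J X⁆ = J Y := by rw [hDJ, hDX]
  simp only [hDX] at hY0 hDY hsurj hind hJXJY
  have hDY1 : ⁅J C, J Y⁆ = 0 := by rw [hDJ, hDY, map_zero]
  have hXC1 : ⁅X, J C⁆ = -Y := by rw [← lie_skew, hDX]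
  have hX1C1 : ⁅J X, J C⁆ = -J Y := by rw [← lie_skew, hDX1]
  have hYC1 : ⁅Y, J C⁆ = 0 := by rw [← lie_skew, hDY, neg_zero]
  have hY1C1 : ⁅J Y, J C⁆ = 0 := by rw [← lie_skew, hDY1, neg_zero]
  -- the image and the kernel of `ad (J C)`
  have hD : ∀ z : g, ∃ a b : ℝ, ⁅J C, z⁆ = a • Y + b • J Y := by
    intro z
    obtain ⟨a0, a1, a2, a3, a4, a5, rfl⟩ := hsurj z
    exact ⟨a0, a1, by simp [hDX, hDX1, hDY, hDY1, hC']⟩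
  have hK : ∀ z : g, ⁅J C, z⁆ = 0 → ∃ a b c d : ℝ, z = a • Y + b • J Y + c • C + d • J C := by
    intro z hz
    obtain ⟨a0, a1, a2, a3, a4, a5, rfl⟩ := hsurj z
    have h := hind 0 0 a0 a1 0 0 (by rw [← hz]; simp [hDX, hDX1, hDY, hDY1, hC'])
    exact ⟨a2, a3, a4, a5, by rw [h.2.2.1, h.2.2.2.1]; module⟩
  -- Write [Y, JY] = aY + bJY + cC + dJC. It is an eigenvector of ad Y with eigenvalue b and, if b =
  -- 0, of ad JY with eigenvalue -a. If both vanish, [Y, JY] = D[X, JY] lies in span(Y, JY) ∩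
  -- span(C, JC) = 0.
  have hYY1 : ⁅Y, J Y⁆ = 0 := by
    have hDW : ⁅J C, ⁅Y, J Y⁆⁆ = 0 := by rw [leibniz_lie, hDY, hDY1, zero_lie, lie_zero, add_zero]
    obtain ⟨a, b, c, d, hW⟩ := hK _ hDW
    by_cases hb : b = 0
    · by_cases ha : a = 0
      · have hD1 : ⁅J C, ⁅X, J Y⁆⁆ = ⁅Y, J Y⁆ := by
          rw [leibniz_lie, hDX, hDY1, lie_zero, add_zero]
        obtain ⟨a', b', h'⟩ := hD ⁅X, J Y⁆
        have h := hind 0 0 a' b' (-c) (-d) (by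
          rw [hD1, hW, ha, hb] at h'
          rw [← sub_eq_zero.mpr h'.symm]
          module)
        rw [hW, ha, hb, neg_eq_zero.mp h.2.2.2.2.1, neg_eq_zero.mp h.2.2.2.2.2]
        module
      · refine eq_zero_of_lie_eq_smul (x := J Y) (neg_ne_zero.mpr ha) ?_
        conv_lhs => rw [hW]
        have : ⁅J Y, Y⁆ = -⁅Y, J Y⁆ := (lie_skew _ _).symm
        simp only [lie_add, lie_smul, this, lie_self, hC', hY1C1]
        module
    · refine eq_zero_of_lie_eq_smul (x := Y) hb ?_
      conv_lhs => rw [hW]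
      simp [hC', hYC1]
  have hY1Y : ⁅J Y, Y⁆ = 0 := by rw [← lie_skew, hYY1, neg_zero]
  obtain ⟨u, hu⟩ : ∃ u, ⁅X, Y⁆ = u := ⟨_, rfl⟩
  obtain ⟨v, hv⟩ : ∃ v, ⁅X, J Y⁆ = v := ⟨_, rfl⟩
  have hDu : ⁅J C, u⁆ = 0 := by rw [← hu, leibniz_lie, hDX, hDY, lie_self, lie_zero, add_zero]
  have hDv : ⁅J C, v⁆ = 0 := by rw [← hv, leibniz_lie, hDX, hDY1, hYY1, lie_zero, add_zero]
  -- the centralizer of `J C` is an abelian ideal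
  let K : Submodule ℝ g := LinearMap.ker (LieAlgebra.ad ℝ g (J C) : g →ₗ[ℝ] g)
  have hKmem : ∀ z, z ∈ K ↔ ⁅J C, z⁆ = 0 := fun z => Iff.rfl
  have hKideal : ∀ x : g, ∀ k ∈ K, ⁅x, k⁆ ∈ K := by
    intro x k hk
    rw [hKmem] at hk ⊢
    obtain ⟨a, b, hab⟩ := hD x
    obtain ⟨a', b', c', d', hk'⟩ := hK k hk
    rw [leibniz_lie, hk, lie_zero, add_zero, hab, hk']
    simp [hYY1, hY1Y, hC', hYC1, hY1C1]
  -- Modulo the ideal K, [X, JX] is an eigenvector of ad X with eigenvalue a1 and of ad JX with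
  -- eigenvalue -a0.
  have hWK : ⁅J C, ⁅X, J X⁆⁆ = 0 := by
    rw [← hKmem]
    obtain ⟨a0, a1, a2, a3, a4, a5, hW⟩ := hsurj ⁅X, J X⁆
    have hk : a2 • Y + a3 • J Y + a4 • C + a5 • J C ∈ K := by
      rw [hKmem]
      simp [hDY, hDY1, hC']
    obtain ⟨k, hkeq⟩ : ∃ k, k = a2 • Y + a3 • J Y + a4 • C + a5 • J C := ⟨_, rfl⟩
    rw [← hkeq] at hk
    have hW' : ⁅X, J X⁆ = a0 • X + a1 • J X + k := by rw [hW, hkeq]; module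
    have hX1X : ⁅J X, X⁆ = -⁅X, J X⁆ := (lie_skew _ _).symm
    by_cases h1 : a1 = 0
    · by_cases h0 : a0 = 0
      · rw [hW', h0, h1, zero_smul, zero_smul, zero_add, zero_add]
        exact hk
      · refine mem_of_lie_sub_smul_mem hKideal (x := J X) (neg_ne_zero.mpr h0) ?_
        have : ⁅J X, ⁅X, J X⁆⁆ - -a0 • ⁅X, J X⁆ = ⁅J X, k⁆ := by
          conv_lhs => enter [1]; rw [hW']
          rw [lie_add, lie_add, lie_smul, lie_smul, lie_self, hX1X]
          module
        rw [this]
        exact hKideal _ _ hk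
    · refine mem_of_lie_sub_smul_mem hKideal (x := X) h1 ?_
      have : ⁅X, ⁅X, J X⁆⁆ - a1 • ⁅X, J X⁆ = ⁅X, k⁆ := by
        conv_lhs => enter [1]; rw [hW']
        rw [lie_add, lie_add, lie_smul, lie_smul, lie_self]
        module
      rw [this]
      exact hKideal _ _ hk
  -- The Jacobi identity applied to D[X, JX] = 0.
  have hX1Y : ⁅J X, Y⁆ = v := by
    rw [leibniz_lie, hDX, hDX1, hv, ← lie_skew] at hWK
    exact (neg_add_eq_zero.mp hWK)
  rw [hX1Y, hu, hv] at hJXJY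
  obtain ⟨u1, u2, u3, u4, hu'⟩ := hK u hDu
  obtain ⟨v1, v2, v3, v4, hv'⟩ := hK v hDv
  have hY_ne : Y ≠ 0 := hY0
  -- a subspace `W` containing `Y` and `J Y`
  have hbr : ∀ W : Submodule ℝ g, Y ∈ W → J Y ∈ W →
      u ∈ bracketSpan W ∧ v ∈ bracketSpan W ∧ J v ∈ bracketSpan W := by
    intro W h1 h2
    have e1 : u ∈ bracketSpan W := hu ▸ lie_mem_bracketSpan X h1
    have e2 : v ∈ bracketSpan W := hv ▸ lie_mem_bracketSpan X h2
    have e3 : J v + J v + u ∈ bracketSpan W := hJXJY ▸ lie_mem_bracketSpan (J X) h2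
    refine ⟨e1, e2, ?_⟩
    have : J v = (1 / 2 : ℝ) • (J v + J v + u - u) := by module
    rw [this]
    exact Submodule.smul_mem _ _ (sub_mem e3 e1)
  have hJv' : J v = v1 • J Y - v2 • Y + v3 • J C - v4 • C := by
    rw [hv']
    simp only [map_add, map_smul, hJJ]
    module
  -- Each coefficient is removed alike: were it nonzero, a span containing Y would lie in its own
  -- bracket span. Here Y and JY come from brackets with JC, and then v and Jv yield C and JC.
  have hv34 : v3 = 0 ∧ v4 = 0 := by
    by_contra hne
    apply hY_ne
    set S : Set g := {Y, J Y, C, J C} with hS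
    refine eq_zero_of_subset_bracketSpan (S := S) ?_ (by simp [hS])
    have m1 : Y ∈ Submodule.span ℝ S := Submodule.subset_span (by simp [hS])
    have m2 : J Y ∈ Submodule.span ℝ S := Submodule.subset_span (by simp [hS])
    have m4 : J C ∈ Submodule.span ℝ S := Submodule.subset_span (by simp [hS])
    obtain ⟨-, b2, b3⟩ := hbr _ m1 m2
    have c1 : Y ∈ bracketSpan (Submodule.span ℝ S) := by
      rw [← neg_mem_iff, ← hXC1]; exact lie_mem_bracketSpan X m4
    have c2 : J Y ∈ bracketSpan (Submodule.span ℝ S) := by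
      rw [← neg_mem_iff, ← hX1C1]; exact lie_mem_bracketSpan (J X) m4
    have c34 := mem_of_add_smul_mem (B := bracketSpan (Submodule.span ℝ S)) (v := C) (v' := J C)
      (a := v3) (b := v4)
      (by
        have : v3 • C + v4 • J C = v - v1 • Y - v2 • J Y := by rw [hv']; module
        rw [this]
        exact sub_mem (sub_mem b2 (Submodule.smul_mem _ _ c1)) (Submodule.smul_mem _ _ c2))
      (by
        have : v3 • J C - v4 • C = J v - v1 • J Y + v2 • Y := by rw [hJv']; module
        rw [this]
        exact add_mem (sub_mem b3 (Submodule.smul_mem _ _ c2)) (Submodule.smul_mem _ _ c1))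
      (by rw [← not_and_or]; exact hne)
    rintro z (rfl | rfl | rfl | rfl)
    exacts [c1, c2, c34.1, c34.2]
  rw [hv34.1, hv34.2, zero_smul, zero_smul, add_zero, add_zero] at hv'
  rw [hv34.1, hv34.2, zero_smul, zero_smul, sub_zero, add_zero] at hJv'
  -- Now v and Jv lie in span(Y, JY). If u4 ≠ 0, then [X, u] and [JX, u] recover Y and JY.
  have hu4 : u4 = 0 := by
    by_contra hne
    apply hY_ne
    set S : Set g := {Y, J Y, u} with hS
    refine eq_zero_of_subset_bracketSpan (S := S) ?_ (by simp [hS])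
    have m1 : Y ∈ Submodule.span ℝ S := Submodule.subset_span (by simp [hS])
    have m2 : J Y ∈ Submodule.span ℝ S := Submodule.subset_span (by simp [hS])
    have m3 : u ∈ Submodule.span ℝ S := Submodule.subset_span (by simp [hS])
    obtain ⟨b1, b2, b3⟩ := hbr _ m1 m2
    have c1 : Y ∈ bracketSpan (Submodule.span ℝ S) := by
      have e : Y = u4⁻¹ • (u1 • u + u2 • v - ⁅X, u⁆) := by
        have : ⁅X, u⁆ = u1 • u + u2 • v - u4 • Y := by
          conv_lhs => rw [hu']
          simp only [lie_add, lie_smul, hu, hv, hC', hXC1]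
          module
        rw [this, sub_sub_cancel, smul_smul, inv_mul_cancel₀ hne, one_smul]
      rw [e]
      exact Submodule.smul_mem _ _ (sub_mem (add_mem (Submodule.smul_mem _ _ b1)
        (Submodule.smul_mem _ _ b2)) (lie_mem_bracketSpan X m3))
    have c2 : J Y ∈ bracketSpan (Submodule.span ℝ S) := by
      have e : J Y = u4⁻¹ • (u1 • v + u2 • (J v + J v + u) - ⁅J X, u⁆) := by
        have : ⁅J X, u⁆ = u1 • v + u2 • (J v + J v + u) - u4 • J Y := by
          conv_lhs => rw [hu']
          simp only [lie_add, lie_smul, hX1Y, hJXJY, hC', hX1C1]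
          module
        rw [this, sub_sub_cancel, smul_smul, inv_mul_cancel₀ hne, one_smul]
      rw [e]
      exact Submodule.smul_mem _ _ (sub_mem (add_mem (Submodule.smul_mem _ _ b2)
        (Submodule.smul_mem _ _ (add_mem (add_mem b3 b3) b1))) (lie_mem_bracketSpan (J X) m3))
    rintro z (rfl | rfl | rfl)
    exacts [c1, c2, b1]
  rw [hu4, zero_smul, add_zero] at hu'
  have hv12 : v1 = 0 ∧ v2 = 0 := by
    by_contra hne
    apply hY_ne
    set S : Set g := {Y, J Y} with hS
    refine eq_zero_of_subset_bracketSpan (S := S) ?_ (by simp [hS])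
    have m1 : Y ∈ Submodule.span ℝ S := Submodule.subset_span (by simp [hS])
    have m2 : J Y ∈ Submodule.span ℝ S := Submodule.subset_span (by simp [hS])
    obtain ⟨-, b2, b3⟩ := hbr _ m1 m2
    have c12 := mem_of_add_smul_mem (B := bracketSpan (Submodule.span ℝ S)) (v := Y) (v' := J Y)
      (a := v1) (b := v2) (hv' ▸ b2) (hJv' ▸ b3) (by rw [← not_and_or]; exact hne)
    rintro z (rfl | rfl)
    exacts [c12.1, c12.2]
  rw [hv12.1, hv12.2, zero_smul, zero_smul, add_zero] at hv'
  rw [hv', map_zero, add_zero, zero_add] at hJXJY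
  rw [hv'] at hv hX1Y
  -- Modulo the central line of C, u1 Y + u2 JY is u itself, so it is an eigenvector with eigenvalue
  -- t. Below, ad X gives t = u1 and ad JX gives t = u2.
  have hu12 : ∀ (t : ℝ) (x : g), ⁅x, u1 • Y + u2 • J Y⁆ = t • u → t ≠ 0 → u1 = 0 ∧ u2 = 0 := by
    intro t x hx ht
    have hmem : u1 • Y + u2 • J Y ∈ Submodule.span ℝ {C} := by
      refine mem_of_lie_sub_smul_mem (x := x) (fun x k hk => ?_) ht ?_
      · obtain ⟨a, rfl⟩ := Submodule.mem_span_singleton.mp hk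
        rw [lie_smul, hC', smul_zero]
        exact zero_mem _
      · rw [hx, Submodule.mem_span_singleton]
        exact ⟨t * u3, by rw [hu']; module⟩
    obtain ⟨a, ha⟩ := Submodule.mem_span_singleton.mp hmem
    have h := hind 0 0 u1 u2 (-a) 0 (by
      rw [← sub_eq_zero.mpr ha.symm]
      module)
    exact ⟨h.2.2.1, h.2.2.2.1⟩
  have hu12' : u1 = 0 ∧ u2 = 0 := by
    by_cases h1 : u1 = 0
    · by_cases h2 : u2 = 0
      · exact ⟨h1, h2⟩
      · exact hu12 u2 (J X) (by simp [hX1Y, hJXJY]) h2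
    · exact hu12 u1 X (by simp [hu, hv]) h1
  rw [hu12'.1, hu12'.2, zero_smul, zero_smul, zero_add, zero_add] at hu'
  obtain ⟨p, q, r, s, hW⟩ := hK _ hWK
  refine ⟨X, C, u3, p, q, r, s, ?_, ?_⟩
  -- If δ = 0, both Y and JY would be central.
  · rintro rfl
    rw [zero_smul] at hu'
    rw [hu'] at hu hJXJY
    apply hY_ne
    apply hZ
    · intro z
      obtain ⟨a0, a1, a2, a3, a4, a5, rfl⟩ := hsurj z
      rw [← lie_skew]
      simp [hu, hX1Y, hY1Y, hC, hDY]
    · intro z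
      obtain ⟨a0, a1, a2, a3, a4, a5, rfl⟩ := hsurj z
      rw [← lie_skew]
      simp [hv, hJXJY, hYY1, hC, hDY1]
  · constructor
    · exact hC
    · rwa [hDX]
    · rwa [hDX]
    · rwa [hDX]
    · rw [hDX, hu, hu']
    · rwa [hDX]
    · rwa [hDX]
    · rw [hDX, hJXJY, hu']
    · rwa [hDX]

end Structure

/-! ### Normalisation of the constants -/

section Normalize

variable {g : Type*} [LieRing g] [LieAlgebra ℝ g] {J : g →ₗ[ℝ] g} {X C : g} {δ p q r s : ℝ}

/-- The added vectors lie in ker D, so Y is unchanged. In [X', JX'] the shift by pC removes pY, that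
by -qJC removes qJY, and the multiple of JY contributes -rC, half through [X, Y] and half through
[JY, JX]. -/
theorem IsFrame.clear (hJ : IsComplexStructure J) (hδ : δ ≠ 0) (h : IsFrame J X C δ p q r s) :
    ∃ X' : g, IsFrame J X' C δ 0 0 0 s := by
  obtain ⟨hC, hY0, hDY, hYY1, hXY, hXY1, hX1Y, hX1Y1, hXX1⟩ := h
  have hC' : ∀ z : g, ⁅z, C⁆ = 0 := fun z => by rw [← lie_skew, hC, neg_zero]
  have hDJ := hJ.lie_J_J hC
  have hJJ := hJ.sq_eq
  obtain ⟨Y, hY⟩ : ∃ Y, Y = ⁅J C, X⁆ := ⟨_, rfl⟩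
  have hDX : ⁅J C, X⁆ = Y := hY.symm
  have hDX1 : ⁅J C, J X⁆ = J Y := by rw [hDJ, hDX]
  simp only [hDX] at hY0 hDY hYY1 hXY hXY1 hX1Y hX1Y1 hXX1
  have hDY1 : ⁅J C, J Y⁆ = 0 := by rw [hDJ, hDY, map_zero]
  have hXC1 : ⁅X, J C⁆ = -Y := by rw [← lie_skew, hDX]
  have hY1C1 : ⁅J Y, J C⁆ = 0 := by rw [← lie_skew, hDY1, neg_zero]
  have hY1Y : ⁅J Y, Y⁆ = 0 := by rw [← lie_skew, hYY1, neg_zero]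
  have hY1X1 : ⁅J Y, J X⁆ = -(δ • C) := by rw [← lie_skew, hX1Y1]
  have hD : ⁅J C, X + p • C - q • J C + (r / (2 * δ)) • J Y⁆ = Y := by
    simp [hDX, hC', hDY1]
  refine ⟨X + p • C - q • J C + (r / (2 * δ)) • J Y, ?_⟩
  constructor
  · exact hC
  all_goals rw [hD]
  · exact hY0
  · exact hDY
  · exact hYY1
  · simp [hXY, hC, hDY, hY1Y]
  · simp [hXY1, hC, hDY1]
  · simp [hJJ, hX1Y, hC, hDY]
  · simp [hJJ, hX1Y1, hC, hDY1, hYY1]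
  · have e : 2 * (r / (2 * δ) * δ) = r := by field_simp
    simp only [map_add, map_sub, map_smul, hJJ, add_lie, sub_lie, smul_lie, lie_add, lie_sub,
      lie_smul, lie_neg, hXX1, hC, hC', hXC1, hXY, hDX1, hDY, hY1X1, hY1C1, hY1Y, lie_self]
    have : r • C = (2 * (r / (2 * δ) * δ)) • C := by rw [e]
    rw [this]
    module

/-- The vector Y is scaled by at. Thus δ changes only by the square a², so its sign persists, while
t is free to normalise s. -/
theorem IsFrame.scale (h : IsFrame J X C δ 0 0 0 s) {a t : ℝ} (ha : a ≠ 0) (ht : t ≠ 0) :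
    IsFrame J (a • X) (t • C) (a ^ 2 * δ) 0 0 0 (a ^ 2 * s / t) := by
  obtain ⟨hC, hY0, hDY, hYY1, hXY, hXY1, hX1Y, hX1Y1, hXX1⟩ := h
  constructor
  · intro z; rw [smul_lie, hC, smul_zero]
  all_goals simp only [map_smul, smul_lie, lie_smul, hDY, hYY1, hXY, hXY1, hX1Y, hX1Y1, hXX1,
    smul_zero, zero_smul, zero_add]
  · exact smul_ne_zero ha (smul_ne_zero ht hY0)
  · module
  · module
  · have : a ^ 2 * s / t * t = a ^ 2 * s := by field_simp
    rw [smul_smul (a ^ 2 * s / t), this]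
    module

theorem IsFrame.exists_isModel [LieRing.IsNilpotent g] (hg : Module.finrank ℝ g = 6)
    (hJ : IsComplexStructure J) {ε c : ℝ} (h : IsFrame J X C (-c) 0 0 0 ε) :
    ∃ e : g ≃ₗ[ℝ] (Fin 6 → ℝ), IsModel e ε c ∧ IsAdapted e J := by
  obtain ⟨hC, hY0, hDY, hYY1, hXY, hXY1, hX1Y, hX1Y1, hXX1⟩ := h
  have : Module.Finite ℝ g := Module.finite_of_finrank_pos (by omega)
  let f := LinearMap.linearEquivOfInjective (frameMap J X C)
    (hJ.frameMap_injective hC hY0 hDY) (by simp [hg])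
  have hf : ∀ a, f a = frameMap J X C a := fun a => rfl
  have hC' : ∀ z : g, ⁅z, C⁆ = 0 := fun z => by rw [← lie_skew, hC, neg_zero]
  have hDJ := hJ.lie_J_J hC
  have hJJ := hJ.sq_eq
  refine ⟨f.symm, fun x y => ?_, fun x => ?_⟩
  · rw [LinearEquiv.symm_apply_eq]
    obtain ⟨a, rfl⟩ := f.surjective x
    obtain ⟨b, rfl⟩ := f.surjective y
    simp only [LinearEquiv.symm_apply_apply]
    rw [hf, hf, hf, frameMap_apply, frameMap_apply, frameMap_apply]
    obtain ⟨Y, hY⟩ : ∃ Y, Y = ⁅J C, X⁆ := ⟨_, rfl⟩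
    have hDX : ⁅J C, X⁆ = Y := hY.symm
    have hDX1 : ⁅J C, J X⁆ = J Y := by rw [hDJ, hDX]
    simp only [hDX] at hY0 hDY hYY1 hXY hXY1 hX1Y hX1Y1 hXX1 ⊢
    have hDY1 : ⁅J C, J Y⁆ = 0 := by rw [hDJ, hDY, map_zero]
    have hXC1 : ⁅X, J C⁆ = -Y := by rw [← lie_skew, hDX]
    have hYC1 : ⁅Y, J C⁆ = 0 := by rw [← lie_skew, hDY, neg_zero]
    have hY1C1 : ⁅J Y, J C⁆ = 0 := by rw [← lie_skew, hDY1, neg_zero]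
    have hX1C1 : ⁅J X, J C⁆ = -J Y := by rw [← lie_skew, hDX1]
    have hY1Y : ⁅J Y, Y⁆ = 0 := by rw [← lie_skew, hYY1, neg_zero]
    have hY1X1 : ⁅J Y, J X⁆ = c • C := by rw [← lie_skew, hX1Y1]; module
    have hYX1 : ⁅Y, J X⁆ = 0 := by rw [← lie_skew, hX1Y, neg_zero]
    have hY1X : ⁅J Y, X⁆ = 0 := by rw [← lie_skew, hXY1, neg_zero]
    have hYX : ⁅Y, X⁆ = c • C := by rw [← lie_skew, hXY]; module
    have hX1X : ⁅J X, X⁆ = -(ε • J C) := by rw [← lie_skew, hXX1]; module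
    simp only [add_lie, smul_lie, lie_add, lie_smul, lie_self, hC, hC', hDX, hDX1, hDY, hDY1,
      hXC1, hYC1, hY1C1, hX1C1, hY1Y, hYY1, hY1X1, hX1Y1, hYX1, hX1Y, hY1X, hXY1, hYX, hXY,
      hX1X, hXX1, modelBracket, Matrix.cons_val]
    module
  · rw [LinearEquiv.symm_apply_eq]
    obtain ⟨a, rfl⟩ := f.surjective x
    simp only [LinearEquiv.symm_apply_apply]
    rw [hf, hf, frameMap_apply, frameMap_apply]
    simp only [map_add, map_smul, hJJ, modelJ_apply, Matrix.cons_val]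
    module

theorem IsNonNilpotentComplexStructure.exists_isModel [LieRing.IsNilpotent g]
    (hg : Module.finrank ℝ g = 6) (hJ : IsNonNilpotentComplexStructure J) :
    ∃ ε c : ℝ, (ε = 0 ∨ ε = 1) ∧ (c = 1 ∨ c = -1) ∧
      ∃ e : g ≃ₗ[ℝ] (Fin 6 → ℝ), IsModel e ε c ∧ IsAdapted e J := by
  obtain ⟨X, C, δ, p, q, r, s, hδ, h⟩ := hJ.1.exists_isFrame hg (hJ.eq_zero_of_central hg)
  obtain ⟨X', h⟩ := h.clear hJ.1 hδ
  -- Take a = |δ|^(-1/2) and c = -sign δ.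
  obtain ⟨a, c, ha, hc, hac⟩ : ∃ a c : ℝ, a ≠ 0 ∧ (c = 1 ∨ c = -1) ∧ a ^ 2 * δ = -c := by
    have hpos : 0 < |δ| := abs_pos.mpr hδ
    refine ⟨(√|δ|)⁻¹, -(δ / |δ|), by positivity, ?_, ?_⟩
    · rcases abs_choice δ with h | h <;> rw [h]
      · right; rw [div_self hδ]
      · left; rw [div_neg, div_self hδ, neg_neg]
    · rw [inv_pow, Real.sq_sqrt hpos.le, neg_neg]
      field_simp
  by_cases hs : s = 0
  · refine ⟨0, c, Or.inl rfl, hc, IsFrame.exists_isModel hg hJ.1 (X := a • X') (C := (1 : ℝ) • C) ?_⟩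
    have := h.scale ha one_ne_zero
    rwa [hac, hs, mul_zero, zero_div] at this
  · have ht : a ^ 2 * s ≠ 0 := mul_ne_zero (pow_ne_zero 2 ha) hs
    refine ⟨1, c, Or.inr rfl, hc,
      IsFrame.exists_isModel hg hJ.1 (X := a • X') (C := (a ^ 2 * s) • C) ?_⟩
    have := h.scale ha ht
    rwa [hac, div_self ht] at this

end Normalize

/-! ### Counting complex structures and the final classification -/

section Classification

theorem mul_self_eq_one_of_sign {c : ℝ} (hc : c = 1 ∨ c = -1) : c * c = 1 := by
  rcases hc with rfl | rfl <;> norm_num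

theorem isEmpty_H19m_lieEquiv_H26p : IsEmpty (H19m ≃ₗ⁅ℝ⁆ H26p) := by
  obtain ⟨e, he⟩ := exists_isModel_H19m (mul_one 1)
  obtain ⟨e', he'⟩ := exists_isModel_H26p (mul_one 1)
  exact he.isEmpty_lieEquiv he' one_ne_zero

/-- A Lie algebra all of whose complex structures have adapted coordinates with one and the same
`ε`, and which is a model for both signs, has exactly two complex structures up to equivalence. -/
theorem card_complexStructureClasses {g : Type*} [LieRing g] [LieAlgebra ℝ g] {ε : ℝ}
    (hmodel : ∀ c : ℝ, c = 1 ∨ c = -1 → ∃ e : g ≃ₗ[ℝ] (Fin 6 → ℝ), IsModel e ε c)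
    (hall : ∀ J : g →ₗ[ℝ] g, IsComplexStructure J → ∃ c : ℝ, (c = 1 ∨ c = -1) ∧
      ∃ e : g ≃ₗ[ℝ] (Fin 6 → ℝ), IsModel e ε c ∧ IsAdapted e J) :
    Nat.card (ComplexStructureClasses g) = 2 := by
  obtain ⟨e, he⟩ := hmodel 1 (Or.inl rfl)
  obtain ⟨e', he'⟩ := hmodel (-1) (Or.inr rfl)
  obtain ⟨J, hJ⟩ := exists_isAdapted e
  obtain ⟨J', hJ'⟩ := exists_isAdapted e'
  rw [Nat.card_eq_two_iff]
  refine ⟨Quotient.mk (complexStructureSetoid g) ⟨J, he.isComplexStructure hJ⟩,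
    Quotient.mk (complexStructureSetoid g) ⟨J', he'.isComplexStructure hJ'⟩, ?_, ?_⟩
  · intro h
    obtain ⟨A, hA⟩ := Quotient.exact h
    -- Pulling the second coordinates back along A gives adapted coordinates for the same J with the
    -- opposite sign.
    have := hJ.sign_unique he (he'.comp A) (hJ'.of_equivalence hA) (Or.inl rfl) (Or.inr rfl)
    norm_num at this
  · rw [Set.eq_univ_iff_forall]
    intro x
    obtain ⟨⟨J₀, hJ₀⟩, rfl⟩ := Quotient.exists_rep x
    obtain ⟨c, rfl | rfl, e₀, he₀, hJe₀⟩ := hall J₀ hJ₀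
    · exact Or.inl (Quotient.sound (he₀.equivalent he hJe₀ hJ))
    · exact Or.inr (Quotient.sound (he₀.equivalent he' hJe₀ hJ'))

end Classification

end NilCx

theorem corollary2p4 :
    -- the two algebras are nilpotent, of dimension 6 and not isomorphic
    (Module.finrank ℝ NilCx.H19m = 6 ∧ LieRing.IsNilpotent NilCx.H19m) ∧
    (Module.finrank ℝ NilCx.H26p = 6 ∧ LieRing.IsNilpotent NilCx.H26p) ∧
    IsEmpty (NilCx.H19m ≃ₗ⁅ℝ⁆ NilCx.H26p) ∧
    -- they are the only 6-dimensional nilpotent ones with a non-nilpotent complex structure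
    (∀ (g : Type*) [LieRing g] [LieAlgebra ℝ g],
      Module.finrank ℝ g = 6 → LieRing.IsNilpotent g →
        ((∃ J : g →ₗ[ℝ] g, NilCx.IsNonNilpotentComplexStructure J) ↔
          (Nonempty (g ≃ₗ⁅ℝ⁆ NilCx.H19m) ∨ Nonempty (g ≃ₗ⁅ℝ⁆ NilCx.H26p)))) ∧
    -- every such complex structure has reduced structure equations, and the value of `ε`
    -- determines the Lie algebra
    (∀ (g : Type*) [LieRing g] [LieAlgebra ℝ g],
      Module.finrank ℝ g = 6 → LieRing.IsNilpotent g →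
        ∀ J : g →ₗ[ℝ] g, NilCx.IsNonNilpotentComplexStructure J →
          (∃ ε c : ℝ, (ε = 0 ∨ ε = 1) ∧ (c = 1 ∨ c = -1) ∧ NilCx.HasReducedBasis J ε c) ∧
          (∀ c : ℝ, (c = 1 ∨ c = -1) → NilCx.HasReducedBasis J 0 c →
            Nonempty (g ≃ₗ⁅ℝ⁆ NilCx.H19m)) ∧
          (∀ c : ℝ, (c = 1 ∨ c = -1) → NilCx.HasReducedBasis J 1 c →
            Nonempty (g ≃ₗ⁅ℝ⁆ NilCx.H26p))) ∧
    -- all complex structures on the two algebras are non-nilpotent, and up to equivalence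
    -- there are exactly two on each
    (∀ J : NilCx.H19m →ₗ[ℝ] NilCx.H19m,
      NilCx.IsComplexStructure J → NilCx.IsNonNilpotentComplexStructure J) ∧
    (∀ J : NilCx.H26p →ₗ[ℝ] NilCx.H26p,
      NilCx.IsComplexStructure J → NilCx.IsNonNilpotentComplexStructure J) ∧
    Nat.card (NilCx.ComplexStructureClasses NilCx.H19m) = 2 ∧
    Nat.card (NilCx.ComplexStructureClasses NilCx.H26p) = 2 := by
  obtain ⟨e₁, he₁⟩ := NilCx.exists_isModel_H19m (mul_one 1)
  obtain ⟨e₂, he₂⟩ := NilCx.exists_isModel_H26p (mul_one 1)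
  have n₁ := he₁.isNilpotent
  have n₂ := he₂.isNilpotent
  have hne := NilCx.isEmpty_H19m_lieEquiv_H26p
  have c₁ : ∀ J : NilCx.H19m →ₗ[ℝ] NilCx.H19m,
      NilCx.IsComplexStructure J → NilCx.IsNonNilpotentComplexStructure J :=
    fun J hJ => he₁.isNonNilpotent one_ne_zero hJ
  have c₂ : ∀ J : NilCx.H26p →ₗ[ℝ] NilCx.H26p,
      NilCx.IsComplexStructure J → NilCx.IsNonNilpotentComplexStructure J :=
    fun J hJ => he₂.isNonNilpotent one_ne_zero hJ
  refine ⟨⟨he₁.finrank_eq, n₁⟩, ⟨he₂.finrank_eq, n₂⟩, hne, ?_, ?_, c₁, c₂, ?_, ?_⟩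
  · intro g _ _ hg _
    constructor
    · rintro ⟨J, hJ⟩
      obtain ⟨ε, c, rfl | rfl, hc, e, he, -⟩ := hJ.exists_isModel hg
      · obtain ⟨e', he'⟩ := NilCx.exists_isModel_H19m (NilCx.mul_self_eq_one_of_sign hc)
        exact Or.inl ⟨he.lieEquiv he'⟩
      · obtain ⟨e', he'⟩ := NilCx.exists_isModel_H26p (NilCx.mul_self_eq_one_of_sign hc)
        exact Or.inr ⟨he.lieEquiv he'⟩
    · rintro (⟨⟨A⟩⟩ | ⟨⟨A⟩⟩)
      · obtain ⟨J, hJ⟩ := NilCx.exists_isAdapted (A.toLinearEquiv.trans e₁)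
        exact ⟨J, (he₁.comp A).isNonNilpotent one_ne_zero ((he₁.comp A).isComplexStructure hJ)⟩
      · obtain ⟨J, hJ⟩ := NilCx.exists_isAdapted (A.toLinearEquiv.trans e₂)
        exact ⟨J, (he₂.comp A).isNonNilpotent one_ne_zero ((he₂.comp A).isComplexStructure hJ)⟩
  · intro g _ _ hg _ J hJ
    refine ⟨?_, ?_, ?_⟩
    · obtain ⟨ε, c, hε, hc, e, he, hJe⟩ := hJ.exists_isModel hg
      exact ⟨ε, c, hε, hc, he.hasReducedBasis hJe⟩
    · intro c hc hb
      obtain ⟨e, he, -⟩ := hb.exists_isModel hJ.1.sq_eq hg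
      obtain ⟨e', he'⟩ := NilCx.exists_isModel_H19m (NilCx.mul_self_eq_one_of_sign hc)
      exact ⟨he.lieEquiv he'⟩
    · intro c hc hb
      obtain ⟨e, he, -⟩ := hb.exists_isModel hJ.1.sq_eq hg
      obtain ⟨e', he'⟩ := NilCx.exists_isModel_H26p (NilCx.mul_self_eq_one_of_sign hc)
      exact ⟨he.lieEquiv he'⟩
  · refine NilCx.card_complexStructureClasses
      (fun c hc => NilCx.exists_isModel_H19m (NilCx.mul_self_eq_one_of_sign hc)) fun J hJ => ?_
    obtain ⟨ε, c, rfl | rfl, hc, e, he, hJe⟩ := (c₁ J hJ).exists_isModel he₁.finrank_eq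
    · exact ⟨c, hc, e, he, hJe⟩
    -- The value of ε is forced, since the two algebras are not isomorphic.
    · obtain ⟨e', he'⟩ := NilCx.exists_isModel_H26p (NilCx.mul_self_eq_one_of_sign hc)
      exact (hne.false (he.lieEquiv he')).elim
  · refine NilCx.card_complexStructureClasses
      (fun c hc => NilCx.exists_isModel_H26p (NilCx.mul_self_eq_one_of_sign hc)) fun J hJ => ?_
    obtain ⟨ε, c, rfl | rfl, hc, e, he, hJe⟩ := (c₂ J hJ).exists_isModel he₂.finrank_eq
    · obtain ⟨e', he'⟩ := NilCx.exists_isModel_H19m (NilCx.mul_self_eq_one_of_sign hc)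
      exact (hne.false (he'.lieEquiv he)).elim
    · exact ⟨c, hc, e, he, hJe⟩
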